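/- All graphs are finite. A \emph{nut graph} is a simple graph whose adjacency matrix has a one-dimensional null space spanned by a vector with no zero entries. For a graph $\Gamma$, $o_v$ and $o_e$ denote the numbers of orbits of $\mathrm{Aut}(\Gamma)$ on the vertices and on the edges. A graph (possibly with loops) is \emph{non-singular} if $0$ is not an eigenvalue of its adjacency matrix, and \emph{arc-transitive} if its automorphism group is transitive on ordered pairs of adjacent vertices. Let $n\ge 5$ be an odd integer such that $n\equiv 1 \pmod 4$ or $n$ is not a prime. Let $m\ge 1$ be an odd integer and $t\ge 2$ an even integer with factorizations $$m=m_0\Big(\prod_{i=1}^{r_1}m_i\Big)\Big(\prod_{i=1}^{q_1}m_i'\Big),\qquad t=t_0\Big(\prod_{j=1}^{r_2}t_j\Big)\Big(\prod_{j=1}^{q_2}t_j'\Big),$$ where $r_1,q_1,r_2,q_2\ge 0$ and $m_0,t_0\ge 1$ are integers, $m_1,\dots,m_{r_1},t_1,\dots,t_{r_2}$ are odd primes (not necessarily distinct), and $m_1',\dots,m_{q_1}',t_1',\dots,t_{q_2}'\ge 2$ are integers. Suppose that there are positive even divisors $d_i$ of $m_i-1$ ($1\le i\le r_1$) and $d_j'$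 of $t_j-1$ ($1\le j\le r_2$) and some $\kappa\in\{4,16\}$ such that $$\kappa\Big(\prod_{i=1}^{r_1}d_i\Big)\Big(\prod_{j=1}^{r_2}d_j'\Big)\Big(\prod_{i=1}^{q_1}(m_i'-1)\Big)\Big(\prod_{j=1}^{q_2}(t_j'-1)\Big)=mt$$ and $$t+4\Big(\prod_{i=1}^{r_1}d_i\Big)\Big(\prod_{i=1}^{q_1}(m_i'-1)\Big)\ne m+\frac{\kappa}{4}\Big(\prod_{j=1}^{r_2}d_j'\Big)\Big(\prod_{j=1}^{q_2}(t_j'-1)\Big).$$ Then there exists a nut graph $\Gamma$ of order $n(m+t)$ with $(o_v,o_e)=(2,3)$. Moreover, $\Gamma$ can be chosen of the following form. There are a connected non-singular arc-transitive tetravalent simple graph $\Lambda$ of order $n$, which is either a circulant $\mathrm{Cay}(\mathbb{Z}_n;S)$ with $n$ prime and $S$ a subgroup of order $4$ of $\mathbb{Z}_n^*$, or a direct product of cycles $C_{n_1}\times C_{n_2}$ with $n=n_1n_2$ and $n_1,n_2\ge 3$, and non-singular arc-transitive graphs $\Lambda_4$ of order $m$ and $\Lambda_5$ of order $t$ (loops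 allowed), such that, with $\Lambda_2=\Lambda$ if $\kappa=16$ and $\Lambda_2$ the graph consisting of a loop at each vertex of $\Lambda$ if $\kappa=4$, the graph $\Gamma$ is obtained from the disjoint union of the direct products $\Lambda\times\Lambda_4$ and $\Lambda_2\times\Lambda_5$ by joining $(i,j)\in V(\Lambda\times\Lambda_4)$ and $(i',j')\in V(\Lambda_2\times\Lambda_5)$ if and only if $i=i'$. In particular, for every such $n$ there exists a nut graph with $(o_v,o_e)=(2,3)$ of order $ns$ for each $s\in\{17,19,23,73,79,97,107,113\}$. -/

import Mathlib

namespace NutGraph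

/-- A finite graph without multiple edges in which loops are allowed. -/
structure LoopGraph (V : Type*) where
  Adj : V → V → Prop
  symm : ∀ u v, Adj u v → Adj v u

namespace LoopGraph

/-- A simple graph, regarded as a graph in which loops are allowed. -/
def ofSimple {V : Type*} (Γ : SimpleGraph V) : LoopGraph V where
  Adj := Γ.Adj
  symm _ _ h := h.symm

/-- The graph consisting of one loop at every vertex, and no other edges. -/
def loops (V : Type*) : LoopGraph V where
  Adj u v := u = v
  symm _ _ h := h.symm

/-- The direct product of two graphs. -/
def prod {V W : Type*} (A : LoopGraph V) (B : LoopGraph W) : LoopGraph (V × W) where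
  Adj x y := A.Adj x.1 y.1 ∧ B.Adj x.2 y.2
  symm _ _ h := ⟨A.symm _ _ h.1, B.symm _ _ h.2⟩

/-- The group of automorphisms is transitive on the arcs, i.e. the ordered pairs of adjacent
vertices (a loop at `v` is the arc `(v, v)`). -/
def IsArcTransitive {V : Type*} (A : LoopGraph V) : Prop :=
  ∀ u v u' v' : V, A.Adj u v → A.Adj u' v' → ∃ φ : A.Adj ≃r A.Adj, φ u = u' ∧ φ v = v'

open Classical in
/-- The real `0`-`1` adjacency matrix (with entry `1` on the diagonal at a loop). -/
noncomputable def adjMatrix {V : Type*} (A : LoopGraph V) : Matrix V V ℝ :=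
  Matrix.of fun u v => if A.Adj u v then 1 else 0

/-- `0` is an eigenvalue of the adjacency matrix. -/
def IsSingular {V : Type*} [Fintype V] [DecidableEq V] (A : LoopGraph V) : Prop :=
  Module.End.HasEigenvalue (Matrix.toLin' A.adjMatrix) 0

/-- The graph on the vertices `v_i^j = inl (i, j)` and `u_i^j = inr (i, j)` which induces the direct
products `Λ₁ × Λ₄` and `Λ₂ × Λ₅` on the two classes of vertices, and in which `v_i^j` and `u_i'^j'`
are adjacent if and only if `i = i'`. -/
def merge {X Y Z : Type*} (Λ₁ Λ₂ : LoopGraph X) (Λ₄ : LoopGraph Y) (Λ₅ : LoopGraph Z) :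
    LoopGraph ((X × Y) ⊕ (X × Z)) where
  Adj
    | .inl x, .inl y => (Λ₁.prod Λ₄).Adj x y
    | .inr x, .inr y => (Λ₂.prod Λ₅).Adj x y
    | .inl x, .inr y => x.1 = y.1
    | .inr x, .inl y => x.1 = y.1
  symm x y h := by
    rcases x with x | x <;> rcases y with y | y
    · exact (Λ₁.prod Λ₄).symm _ _ h
    · exact Eq.symm h
    · exact Eq.symm h
    · exact (Λ₂.prod Λ₅).symm _ _ h

end LoopGraph

open Classical in
/-- A nut graph: the null space of the adjacency matrix is one-dimensional, and is spanned by a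
vector having no zero entries. -/
def IsNut {V : Type*} [Fintype V] (Γ : SimpleGraph V) : Prop :=
  Module.finrank ℝ (LinearMap.ker (Matrix.toLin' (Γ.adjMatrix ℝ))) = 1 ∧
    ∃ x : V → ℝ, (∀ v, x v ≠ 0) ∧ LinearMap.ker (Matrix.toLin' (Γ.adjMatrix ℝ)) = ℝ ∙ x

/-- The number `o_v` of orbits of the automorphism group on the vertices. -/
noncomputable def numVertexOrbits {V : Type*} (Γ : SimpleGraph V) : ℕ :=
  {O : Set V | ∃ v, O = {w | ∃ φ : Γ ≃g Γ, φ v = w}}.ncard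

/-- The number `o_e` of orbits of the automorphism group on the edges. -/
noncomputable def numEdgeOrbits {V : Type*} (Γ : SimpleGraph V) : ℕ :=
  {O : Set (Sym2 V) | ∃ e ∈ Γ.edgeSet, O = {f | ∃ φ : Γ ≃g Γ, Sym2.map φ e = f}}.ncard

/-- A nut graph with two vertex orbits and three edge orbits. -/
def IsNutTwoThree {V : Type*} [Fintype V] (Γ : SimpleGraph V) : Prop :=
  IsNut Γ ∧ numVertexOrbits Γ = 2 ∧ numEdgeOrbits Γ = 3

/-- `Λ` is the circulant `Cay(ℤ_n; S)` of prime order `n`, where `S` is a subgroup of order `4` of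
the group of units of `ℤ_n`. -/
def IsTetravalentPrimeCirculant {V : Type*} (n : ℕ) (Λ : SimpleGraph V) : Prop :=
  n.Prime ∧ ∃ S : Subgroup (ZMod n)ˣ, Nat.card S = 4 ∧
    Nonempty (Λ ≃g SimpleGraph.circulantGraph {x : ZMod n | ∃ u ∈ S, (u : ZMod n) = x})

/-- `Λ` is a direct product of cycles `C_{n₁} × C_{n₂}` with `n = n₁ n₂` and `n₁, n₂ ≥ 3`. -/
def IsProductOfTwoCycles {V : Type*} (n : ℕ) (Λ : SimpleGraph V) : Prop :=
  ∃ n₁ n₂ : ℕ, 3 ≤ n₁ ∧ 3 ≤ n₂ ∧ n = n₁ * n₂ ∧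
    Nonempty (Λ.Adj ≃r ((LoopGraph.ofSimple (SimpleGraph.cycleGraph n₁)).prod
      (LoopGraph.ofSimple (SimpleGraph.cycleGraph n₂))).Adj)

end NutGraph

/-! The two sides of the merged graph form an equitable partition. If `Λ₂`, `Λ₄`, `Λ₅` have degrees
b = κ/4, d₄, d₅, the quotient matrix has rows (4d₄, t) and (m, b·d₅). It is singular exactly when
4b·d₄d₅ = mt, which is the product condition, and then the vector equal to t on the left and to -4d₄
on the right is a nowhere zero null vector.

It spans the null space. For a null vector f, the operator of `Λ × Λ₄` sends the left part of f to a
function of the `Λ`-coordinate alone. That operator is invertible and `Λ₄` is regular, so the left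
part is itself a function h of that coordinate (`exists_eq_comp_fst`), and the right part is
likewise a function k. Eliminating k gives A₂A₁h = 4b·h, where A₁ and A₂ are the matrices of `Λ` and
`Λ₂`. For κ = 4 this is A₁h = 4h, for κ = 16 it is A₁²h = 16h. Since `Λ` is connected of odd order,
-4 is not an eigenvalue and 4 is simple, so h is constant (`exists_eq_mul_of_merge_ker`).

The degree inequality keeps automorphisms from exchanging the sides (`isLeft_mergeAut`), while
automorphisms of the factors are transitive on vertices of each side and on arcs of each type. This
leaves two vertex orbits and three edge orbits.

The factors are direct products of loop graphs, complete graphs and prime circulants. Products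
preserve arc-transitivity and invertibility and multiply degrees. Prime circulants are invertible by
a determinant computation modulo p (`hasTrivialKer_circulant_of_prime`). -/

namespace NutGraph

/-! ### Adjacency matrices, direct products, and the elementary arc-transitive graphs. -/

namespace LoopGraph

variable {V W : Type*}

theorem adjMatrix_of_adj {A : LoopGraph V} {u v : V} (h : A.Adj u v) : A.adjMatrix u v = 1 := by
  simp [adjMatrix, h]

theorem adjMatrix_of_not_adj {A : LoopGraph V} {u v : V} (h : ¬ A.Adj u v) :
    A.adjMatrix u v = 0 := by
  simp [adjMatrix, h]

theorem adjMatrix_comm (A : LoopGraph V) (u v : V) : A.adjMatrix u v = A.adjMatrix v u := by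
  by_cases h : A.Adj u v
  · rw [adjMatrix_of_adj h, adjMatrix_of_adj (A.symm _ _ h)]
  · rw [adjMatrix_of_not_adj h, adjMatrix_of_not_adj fun h' => h (A.symm _ _ h')]

theorem adjMatrix_iso {A : LoopGraph V} {B : LoopGraph W} (e : A.Adj ≃r B.Adj) (u v : V) :
    B.adjMatrix (e u) (e v) = A.adjMatrix u v := by
  by_cases h : A.Adj u v
  · rw [adjMatrix_of_adj h, adjMatrix_of_adj (e.map_rel_iff.2 h)]
  · rw [adjMatrix_of_not_adj h, adjMatrix_of_not_adj fun h' => h (e.map_rel_iff.1 h')]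

theorem adjMatrix_prod (A : LoopGraph V) (B : LoopGraph W) (x y : V × W) :
    (A.prod B).adjMatrix x y = A.adjMatrix x.1 y.1 * B.adjMatrix x.2 y.2 := by
  by_cases h : A.Adj x.1 y.1
  · by_cases h' : B.Adj x.2 y.2
    · have : (A.prod B).Adj x y := ⟨h, h'⟩
      rw [adjMatrix_of_adj h, adjMatrix_of_adj h', adjMatrix_of_adj this, one_mul]
    · have : ¬ (A.prod B).Adj x y := fun h'' => h' h''.2
      rw [adjMatrix_of_not_adj h', adjMatrix_of_not_adj this, mul_zero]
  · have : ¬ (A.prod B).Adj x y := fun h'' => h h''.1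
    rw [adjMatrix_of_not_adj h, adjMatrix_of_not_adj this, zero_mul]

/-- Every row of the adjacency matrix sums to `d`. -/
def HasDegree [Fintype V] (A : LoopGraph V) (d : ℕ) : Prop :=
  ∀ v, ∑ w, A.adjMatrix v w = d

theorem sum_adjMatrix_eq_ncard [Fintype V] (A : LoopGraph V) (v : V) :
    ∑ w, A.adjMatrix v w = {w | A.Adj v w}.ncard := by
  classical
  simp only [adjMatrix, Matrix.of_apply]
  rw [Finset.sum_boole, ← Set.ncard_coe_finset]
  congr 2
  ext w
  simp

theorem HasDegree.exists_adj [Fintype V] {A : LoopGraph V} {d : ℕ} (h : A.HasDegree d)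
    (hd : d ≠ 0) (v : V) : ∃ w, A.Adj v w := by
  by_contra! hc
  have := h v
  rw [Finset.sum_eq_zero fun w _ => adjMatrix_of_not_adj (hc w)] at this
  exact hd (by exact_mod_cast this.symm)

/-- The adjacency operator has trivial kernel. -/
def HasTrivialKer [Fintype V] (A : LoopGraph V) : Prop :=
  ∀ x : V → ℝ, (∀ v, ∑ w, A.adjMatrix v w * x w = 0) → ∀ v, x v = 0

theorem HasTrivialKer.not_isSingular [Fintype V] [DecidableEq V] {A : LoopGraph V}
    (h : A.HasTrivialKer) : ¬ A.IsSingular := by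
  intro hs
  obtain ⟨x, hx⟩ := hs.exists_hasEigenvector
  refine hx.2 (funext (h x fun v => ?_))
  have := congrFun hx.apply_eq_smul v
  simpa [Matrix.mulVec, dotProduct] using this

theorem HasTrivialKer.exists_preimage [Fintype V] {A : LoopGraph V} (h : A.HasTrivialKer)
    (c : V → ℝ) : ∃ x : V → ℝ, ∀ v, ∑ w, A.adjMatrix v w * x w = c v := by
  classical
  have hinj : Function.Injective (Matrix.toLin' A.adjMatrix) := by
    rw [injective_iff_map_eq_zero]
    intro x hx
    refine funext (h x fun v => ?_)
    simpa [Matrix.mulVec, dotProduct] using congrFun hx v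
  obtain ⟨x, hx⟩ := LinearMap.surjective_of_injective hinj c
  exact ⟨x, fun v => by simpa [Matrix.mulVec, dotProduct] using congrFun hx v⟩

/-- A symmetric graph whose adjacency matrix is invertible and has constant row sums `d`. -/
structure IsGood [Fintype V] (A : LoopGraph V) (d : ℕ) : Prop where
  arcTransitive : A.IsArcTransitive
  vertexTransitive : ∀ u v : V, ∃ φ : A.Adj ≃r A.Adj, φ u = v
  trivialKer : A.HasTrivialKer
  degree : A.HasDegree d

theorem IsGood.iso [Fintype V] [Fintype W] {A : LoopGraph V} {B : LoopGraph W} {d : ℕ}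
    (h : A.IsGood d) (e : A.Adj ≃r B.Adj) : B.IsGood d where
  arcTransitive u v u' v' huv huv' := by
    obtain ⟨φ, h1, h2⟩ := h.arcTransitive (e.symm u) (e.symm v) (e.symm u') (e.symm v')
      (e.symm.map_rel_iff.2 huv) (e.symm.map_rel_iff.2 huv')
    exact ⟨(e.symm.trans φ).trans e, by simp [h1], by simp [h2]⟩
  vertexTransitive u v := by
    obtain ⟨φ, h1⟩ := h.vertexTransitive (e.symm u) (e.symm v)
    exact ⟨(e.symm.trans φ).trans e, by simp [h1]⟩
  trivialKer x hx v := by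
    have := h.trivialKer (x ∘ e) (fun u => by
      rw [← hx (e u), ← e.toEquiv.sum_comp]
      refine Finset.sum_congr rfl fun w _ => ?_
      exact congrArg (· * _) (adjMatrix_iso e u w).symm) (e.symm v)
    simpa using this
  degree v := by
    rw [← h.degree (e.symm v), ← e.toEquiv.sum_comp]
    refine Finset.sum_congr rfl fun w _ => ?_
    rw [← adjMatrix_iso e, RelIso.apply_symm_apply]
    rfl

/-- The product of two isomorphisms. -/
def prodIso {V' W' : Type*} {A : LoopGraph V} {A' : LoopGraph V'} {B : LoopGraph W}
    {B' : LoopGraph W'} (φ : A.Adj ≃r A'.Adj) (ψ : B.Adj ≃r B'.Adj) :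
    (A.prod B).Adj ≃r (A'.prod B').Adj where
  toEquiv := φ.toEquiv.prodCongr ψ.toEquiv
  map_rel_iff' := and_congr φ.map_rel_iff ψ.map_rel_iff

theorem HasTrivialKer.prod [Fintype V] [Fintype W] {A : LoopGraph V} {B : LoopGraph W}
    (hA : A.HasTrivialKer) (hB : B.HasTrivialKer) : (A.prod B).HasTrivialKer := by
  rintro x hx ⟨v, w⟩
  refine hB (fun w => x (v, w)) (fun w' => ?_) w
  refine hA (fun v => ∑ w, B.adjMatrix w' w * x (v, w)) (fun v' => ?_) v
  rw [← hx (v', w'), Fintype.sum_prod_type]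
  simp only [adjMatrix_prod, Finset.mul_sum, mul_assoc]

theorem HasDegree.prod [Fintype V] [Fintype W] {A : LoopGraph V} {B : LoopGraph W} {a b : ℕ}
    (hA : A.HasDegree a) (hB : B.HasDegree b) : (A.prod B).HasDegree (a * b) := by
  rintro ⟨v, w⟩
  simp only [adjMatrix_prod, Fintype.sum_prod_type, ← Finset.mul_sum, hB w, ← Finset.sum_mul, hA v]
  push_cast; rfl

theorem IsGood.prod [Fintype V] [Fintype W] {A : LoopGraph V} {B : LoopGraph W} {a b : ℕ}
    (hA : A.IsGood a) (hB : B.IsGood b) : (A.prod B).IsGood (a * b) where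
  arcTransitive u v u' v' h h' := by
    obtain ⟨φ, h1, h2⟩ := hA.arcTransitive _ _ _ _ h.1 h'.1
    obtain ⟨ψ, h3, h4⟩ := hB.arcTransitive _ _ _ _ h.2 h'.2
    exact ⟨prodIso φ ψ, Prod.ext h1 h3, Prod.ext h2 h4⟩
  vertexTransitive u v := by
    obtain ⟨φ, h1⟩ := hA.vertexTransitive u.1 v.1
    obtain ⟨ψ, h3⟩ := hB.vertexTransitive u.2 v.2
    exact ⟨prodIso φ ψ, Prod.ext h1 h3⟩
  trivialKer := hA.trivialKer.prod hB.trivialKer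
  degree := hA.degree.prod hB.degree

theorem adjMatrix_loops [DecidableEq V] (u v : V) :
    (loops V).adjMatrix u v = if u = v then 1 else 0 := by
  by_cases h : u = v <;> simp [adjMatrix, loops, h]

/-- Every permutation is an automorphism of the graph of loops. -/
def loopsAut (e : V ≃ V) : (loops V).Adj ≃r (loops V).Adj where
  toEquiv := e
  map_rel_iff' := e.injective.eq_iff

theorem isGood_loops [Fintype V] : (loops V).IsGood 1 where
  arcTransitive u v u' v' h h' := by
    classical
    cases h; cases h'
    exact ⟨loopsAut (Equiv.swap u u'), Equiv.swap_apply_left _ _, Equiv.swap_apply_left _ _⟩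
  vertexTransitive u v := by
    classical
    exact ⟨loopsAut (Equiv.swap u v), Equiv.swap_apply_left _ _⟩
  trivialKer x hx v := by
    classical
    simpa [adjMatrix_loops] using hx v
  degree v := by
    classical
    simp [adjMatrix_loops]

/-- The complete graph. -/
def complete (V : Type*) : LoopGraph V where
  Adj u v := u ≠ v
  symm _ _ h := h.symm

/-- Every permutation is an automorphism of the complete graph. -/
def completeAut (e : V ≃ V) : (complete V).Adj ≃r (complete V).Adj where
  toEquiv := e
  map_rel_iff' := e.injective.ne_iff

theorem adjMatrix_complete [DecidableEq V] (u v : V) :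
    (complete V).adjMatrix u v = 1 - if u = v then 1 else 0 := by
  by_cases h : u = v
  · rw [adjMatrix_of_not_adj (not_not_intro h : ¬ (complete V).Adj u v)]; simp [h]
  · rw [adjMatrix_of_adj (h : (complete V).Adj u v)]; simp [h]

theorem isGood_complete [Fintype V] (hV : 2 ≤ Fintype.card V) :
    (complete V).IsGood (Fintype.card V - 1) where
  arcTransitive u v u' v' h h' := by
    classical
    -- The second swap corrects the image of `v` and fixes `u'`, since neither of the points it
    -- exchanges is `u'`.
    refine ⟨completeAut ((Equiv.swap u u').trans (Equiv.swap (Equiv.swap u u' v) v')), ?_, ?_⟩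
    · change Equiv.swap _ _ (Equiv.swap u u' u) = u'
      rw [Equiv.swap_apply_left, Equiv.swap_apply_of_ne_of_ne _ h']
      intro hc
      have := congrArg (Equiv.swap u u') hc
      rw [Equiv.swap_apply_right, Equiv.swap_apply_self] at this
      exact h this
    · change Equiv.swap _ _ (Equiv.swap u u' v) = v'
      rw [Equiv.swap_apply_left]
  vertexTransitive u v := by
    classical
    exact ⟨completeAut (Equiv.swap u v), Equiv.swap_apply_left _ _⟩
  trivialKer x hx := by
    classical
    have hx' : ∀ v, x v = ∑ w, x w := fun v => by
      have := hx v
      simp only [adjMatrix_complete, sub_mul, one_mul, Finset.sum_sub_distrib, ite_mul, zero_mul,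
        Finset.sum_ite_eq, Finset.mem_univ, if_true] at this
      linarith
    -- Summing `hx'` over all vertices; with at least two vertices the total must vanish, and every
    -- `x v` equals that total.
    have hs : ∑ w, x w = Fintype.card V * ∑ w, x w := by
      nth_rewrite 1 [Finset.sum_congr rfl fun v _ => hx' v]
      simp
    have h2 : (2 : ℝ) ≤ Fintype.card V := by exact_mod_cast hV
    have h0 : ∑ w, x w = 0 := by
      have : (Fintype.card V - 1 : ℝ) * ∑ w, x w = 0 := by linarith
      rcases mul_eq_zero.1 this with h | h
      · linarith
      · exact h
    intro v
    rw [hx', h0]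
  degree v := by
    classical
    simp only [adjMatrix_complete, Finset.sum_sub_distrib, Finset.sum_ite_eq, Finset.mem_univ,
        if_true]
    rw [Nat.cast_sub (by omega)]
    simp

/-- The circulant on `ZMod k` whose connection set is a group of units containing `-1`. -/
def circulant (k : ℕ) (S : Subgroup (ZMod k)ˣ) (hS : -1 ∈ S) : LoopGraph (ZMod k) where
  Adj x y := ∃ u ∈ S, x + (u : ZMod k) = y
  symm x y := by
    rintro ⟨u, hu, rfl⟩
    exact ⟨-1 * u, S.mul_mem hS hu, by simp⟩

variable {k : ℕ} {S : Subgroup (ZMod k)ˣ} {hS : -1 ∈ S}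

/-- The affine map `x ↦ u (x - a) + b` is an automorphism of the circulant. -/
def circulantAut (u : (ZMod k)ˣ) (hu : u ∈ S) (a b : ZMod k) :
    (circulant k S hS).Adj ≃r (circulant k S hS).Adj where
  toEquiv :=
    { toFun x := u * (x - a) + b
      invFun x := (u⁻¹ : (ZMod k)ˣ) * (x - b) + a
      left_inv x := by simp
      right_inv x := by simp }
  map_rel_iff' := by
    intro x y
    constructor
    · rintro ⟨w, hw, h⟩
      refine ⟨u⁻¹ * w, S.mul_mem (S.inv_mem hu) hw, ?_⟩
      have h' : (u : ZMod k) * (y - x) = w := by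
        simp only [Equiv.coe_fn_mk] at h
        linear_combination -h
      rw [Units.val_mul, ← h', Units.inv_mul_cancel_left]
      ring
    · rintro ⟨w, hw, rfl⟩
      refine ⟨u * w, S.mul_mem hu hw, ?_⟩
      simp only [Equiv.coe_fn_mk, Units.val_mul]
      ring

theorem sum_circulant [NeZero k] [Fintype S] {R : Type*} [AddCommMonoid R] (a : ZMod k)
    (f : ZMod k → R) [DecidablePred ((circulant k S hS).Adj a)] :
    ∑ b, (if (circulant k S hS).Adj a b then f b else 0) = ∑ u : S, f (a + (u : (ZMod k)ˣ)) := by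
  classical
  rw [← Finset.sum_filter]
  symm
  refine Finset.sum_bij (fun u _ => a + ((u : (ZMod k)ˣ) : ZMod k)) ?_ ?_ ?_ ?_
  · intro u _
    simp only [Finset.mem_filter, Finset.mem_univ, true_and]
    exact ⟨u, u.2, rfl⟩
  · intro u _ v _ h
    exact Subtype.ext (Units.ext (add_left_cancel h))
  · intro b hb
    obtain ⟨u, hu, h⟩ := (Finset.mem_filter.1 hb).2
    exact ⟨⟨u, hu⟩, Finset.mem_univ _, h⟩
  · intro u _
    rfl

theorem sum_adjMatrix_circulant [NeZero k] [Fintype S] (a : ZMod k) (f : ZMod k → ℝ) :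
    ∑ b, (circulant k S hS).adjMatrix a b * f b = ∑ u : S, f (a + (u : (ZMod k)ˣ)) := by
  classical
  rw [← sum_circulant (hS := hS)]
  refine Finset.sum_congr rfl fun b _ => ?_
  by_cases h : (circulant k S hS).Adj a b
  · rw [adjMatrix_of_adj h, if_pos h, one_mul]
  · rw [adjMatrix_of_not_adj h, if_neg h, zero_mul]

theorem hasDegree_circulant [NeZero k] : (circulant k S hS).HasDegree (Nat.card S) := by
  intro a
  have := Fintype.ofFinite S
  have := sum_adjMatrix_circulant (hS := hS) a fun _ => 1
  simpa [Nat.card_eq_fintype_card] using this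

theorem isGood_circulant [NeZero k] (h : (circulant k S hS).HasTrivialKer) :
    (circulant k S hS).IsGood (Nat.card S) where
  arcTransitive := by
    rintro a _ b _ ⟨u, hu, rfl⟩ ⟨v, hv, rfl⟩
    refine ⟨circulantAut (v * u⁻¹) (S.mul_mem hv (S.inv_mem hu)) a b, ?_, ?_⟩
    · change ((v * u⁻¹ : (ZMod k)ˣ) : ZMod k) * (a - a) + b = b
      ring
    · change ((v * u⁻¹ : (ZMod k)ˣ) : ZMod k) * (a + u - a) + b = b + v
      rw [add_sub_cancel_left, ← Units.val_mul, inv_mul_cancel_right, add_comm]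
  vertexTransitive a b := by
    refine ⟨circulantAut 1 S.one_mem a b, ?_⟩
    change ((1 : (ZMod k)ˣ) : ZMod k) * (a - a) + b = b
    ring
  trivialKer := h
  degree := hasDegree_circulant

end LoopGraph

end NutGraph

/-! ### Invertibility of prime circulants and of odd cycles. -/

namespace NutGraph

namespace LoopGraph

section Shift

variable {p : ℕ} [Fact p.Prime]

/-- The permutation matrix of a translation of `ZMod p`. -/
def shiftMatrix (u : ZMod p) : Matrix (ZMod p) (ZMod p) (ZMod p) :=
  Matrix.of fun a b => if a + u = b then 1 else 0

theorem shiftMatrix_mul (u v : ZMod p) :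
    shiftMatrix u * shiftMatrix v = shiftMatrix (u + v) := by
  ext a b
  simp only [shiftMatrix, Matrix.mul_apply, Matrix.of_apply, ite_mul, one_mul, zero_mul,
    Finset.sum_ite_eq, Finset.mem_univ, if_true, add_assoc]

theorem shiftMatrix_zero : shiftMatrix (0 : ZMod p) = 1 := by
  ext a b
  simp [shiftMatrix, Matrix.one_apply]

theorem shiftMatrix_pow (u : ZMod p) (k : ℕ) : shiftMatrix u ^ k = shiftMatrix ((k : ZMod p) * u) := by
  induction k with
  | zero => simp [shiftMatrix_zero]
  | succ k ih =>
    rw [pow_succ, ih, shiftMatrix_mul]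
    congr 1
    push_cast
    ring

/-- Shifts commute, so the p-th power is additive on their sums in characteristic p, and each shift
has p-th power 1. -/
theorem sum_shiftMatrix_pow {ι : Type*} (s : Finset ι) (f : ι → ZMod p) :
    (∑ i ∈ s, shiftMatrix (f i)) ^ p = (s.card : Matrix (ZMod p) (ZMod p) (ZMod p)) := by
  classical
  have := Matrix.charP (n := ZMod p) (R := ZMod p) p
  induction s using Finset.induction_on with
  | empty => simp [(Fact.out : p.Prime).ne_zero]
  | insert i s hi ih =>
    rw [Finset.sum_insert hi, add_pow_char_of_commute, ih, shiftMatrix_pow, CharP.cast_eq_zero,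
      zero_mul, shiftMatrix_zero, Finset.card_insert_of_notMem hi]
    · push_cast
      rw [add_comm]
    · refine Commute.sum_right _ _ _ fun j _ => ?_
      rw [commute_iff_eq, shiftMatrix_mul, shiftMatrix_mul, add_comm]

/-- Modulo p the adjacency matrix is a sum of |S| shifts, so its p-th power is the scalar |S|. This
is nonzero because |S| divides p - 1. Hence the integer determinant is not divisible by p, so it is
nonzero over the reals as well. -/
theorem hasTrivialKer_circulant_of_prime {S : Subgroup (ZMod p)ˣ} {hS : -1 ∈ S} :
    (circulant p S hS).HasTrivialKer := by
  classical
  have := Fintype.ofFinite S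
  let M : Matrix (ZMod p) (ZMod p) ℤ :=
    Matrix.of fun a b => if (circulant p S hS).Adj a b then 1 else 0
  have hM : M.map (Int.castRingHom (ZMod p)) = ∑ u : S, shiftMatrix ((u : (ZMod p)ˣ) : ZMod p) := by
    ext a b
    rw [Matrix.sum_apply]
    simp only [shiftMatrix, Matrix.of_apply]
    have h := sum_circulant (hS := hS) a fun c => if c = b then (1 : ZMod p) else 0
    rw [← h, Finset.sum_eq_single b (fun c _ hc => by simp [hc]) (by simp)]
    simp [M]
  have hdet : (M.map (Int.castRingHom (ZMod p))).det ^ p ≠ 0 := by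
    rw [← Matrix.det_pow, hM, sum_shiftMatrix_pow, Finset.card_univ, ← Matrix.diagonal_natCast,
      Matrix.det_diagonal, Finset.prod_const]
    refine pow_ne_zero _ fun h0 => ?_
    have hdvd := (ZMod.natCast_eq_zero_iff _ _).1 h0
    have h1 : Fintype.card S ∣ p - 1 := by
      rw [← ZMod.card_units p, ← Nat.card_eq_fintype_card, ← Nat.card_eq_fintype_card]
      exact S.card_subgroup_dvd_card
    have h2 := (Fact.out : p.Prime).two_le
    have h3 := Nat.le_of_dvd (by omega) (hdvd.trans h1)
    omega
  have hdet' : M.det ≠ 0 := by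
    intro h0
    rw [← RingHom.mapMatrix_apply, ← RingHom.map_det, h0, map_zero] at hdet
    exact hdet (zero_pow (Fact.out : p.Prime).ne_zero)
  have hadj : (circulant p S hS).adjMatrix = M.map (Int.castRingHom ℝ) := by
    ext a b
    simp only [adjMatrix, M, Matrix.of_apply, Matrix.map_apply]
    split_ifs <;> simp
  have hdetR : (circulant p S hS).adjMatrix.det ≠ 0 := by
    rw [hadj, ← RingHom.mapMatrix_apply, ← RingHom.map_det]
    simpa using hdet'
  intro x hx v
  by_contra hv
  refine hdetR (Matrix.exists_mulVec_eq_zero_iff.1 ⟨x, fun h => hv (congrFun h v), ?_⟩)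
  ext w
  exact hx w

end Shift

section Cycle

variable {k : ℕ}

/-- The cycle of length `k`. -/
def cycle (k : ℕ) : LoopGraph (ZMod k) :=
  circulant k (Subgroup.zpowers (-1)) (Subgroup.mem_zpowers _)

theorem neg_one_unit_ne_one (hk : 3 ≤ k) : (-1 : (ZMod k)ˣ) ≠ 1 := by
  intro h
  have h' : ((2 : ℕ) : ZMod k) = 0 := by
    have := congrArg Units.val h
    simp only [Units.val_neg, Units.val_one] at this
    push_cast
    linear_combination -this
  have := Nat.le_of_dvd (by norm_num) ((ZMod.natCast_eq_zero_iff _ _).1 h')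
  omega

theorem mem_zpowers_neg_one {u : (ZMod k)ˣ} :
    u ∈ Subgroup.zpowers (-1 : (ZMod k)ˣ) ↔ u = 1 ∨ u = -1 := by
  constructor
  · rintro ⟨z, rfl⟩
    rcases Int.even_or_odd z with h | h
    · exact .inl h.neg_one_zpow
    · exact .inr h.neg_one_zpow
  · rintro (rfl | rfl)
    · exact Subgroup.one_mem _
    · exact Subgroup.mem_zpowers _

theorem cycle_adj {a b : ZMod k} : (cycle k).Adj a b ↔ a + 1 = b ∨ a - 1 = b := by
  constructor
  · rintro ⟨u, hu, rfl⟩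
    rcases mem_zpowers_neg_one.1 hu with rfl | rfl
    · simp
    · simp [sub_eq_add_neg]
  · rintro (rfl | rfl)
    · exact ⟨1, Subgroup.one_mem _, by simp⟩
    · exact ⟨-1, Subgroup.mem_zpowers _, by simp [sub_eq_add_neg]⟩

theorem card_zpowers_neg_one (hk : 3 ≤ k) : Nat.card (Subgroup.zpowers (-1 : (ZMod k)ˣ)) = 2 := by
  rw [Nat.card_zpowers]
  exact orderOf_eq_prime (by simp) (neg_one_unit_ne_one hk)

/-- A null vector changes sign under translation by 2. After `k` such translations one is back at
the start with sign (-1)^k = -1. -/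
theorem hasTrivialKer_cycle (hk : 3 ≤ k) (hodd : Odd k) [NeZero k] : (cycle k).HasTrivialKer := by
  classical
  have hs : ∀ (x : ZMod k → ℝ) a, ∑ b, (cycle k).adjMatrix a b * x b = x (a + 1) + x (a - 1) := by
    intro x a
    have hne : a + 1 ≠ a - 1 := by
      intro h
      apply neg_one_unit_ne_one hk
      ext
      simp only [Units.val_neg, Units.val_one]
      linear_combination -h
    rw [← Finset.sum_subset (Finset.subset_univ {a + 1, a - 1}), Finset.sum_pair hne,
      adjMatrix_of_adj (cycle_adj.2 (.inl rfl)), adjMatrix_of_adj (cycle_adj.2 (.inr rfl)),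
      one_mul, one_mul]
    intro b _ hb
    rw [adjMatrix_of_not_adj, zero_mul]
    intro h
    rcases cycle_adj.1 h with rfl | rfl <;> simp at hb
  intro x hx
  have h2 : ∀ a, x (a + 2) = -x a := fun a => by
    have := hx (a + 1)
    rw [hs, add_sub_cancel_right, add_assoc, one_add_one_eq_two] at this
    linarith
  have hj : ∀ (j : ℕ) a, x (a + 2 * j) = (-1) ^ j * x a := by
    intro j
    induction j with
    | zero => simp
    | succ j ih =>
      intro a
      have : a + 2 * ((j + 1 : ℕ) : ZMod k) = (a + 2 * j) + 2 := by push_cast; ring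
      rw [this, h2, ih, pow_succ]
      ring
  intro a
  have := hj k a
  rw [CharP.cast_eq_zero, mul_zero, add_zero, hodd.neg_one_pow] at this
  linarith

theorem isGood_cycle (hk : 3 ≤ k) (hodd : Odd k) [NeZero k] : (cycle k).IsGood 2 := by
  rw [← card_zpowers_neg_one hk]
  exact isGood_circulant (hasTrivialKer_cycle hk hodd)

theorem cycle_loopless (hk : 3 ≤ k) (a : ZMod k) : ¬ (cycle k).Adj a a := by
  have : Fact (1 < k) := ⟨by omega⟩
  rw [cycle_adj]
  rintro (h | h) <;> simp at h

/-- The cycle agrees with Mathlib's cycle graph. -/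
theorem exists_cycle_iso (hk : 3 ≤ k) :
    Nonempty ((cycle k).Adj ≃r (ofSimple (SimpleGraph.cycleGraph k)).Adj) := by
  obtain ⟨l, rfl⟩ := Nat.exists_eq_add_of_le' hk
  -- `ZMod (l + 3)` unfolds to `Fin (l + 3)`, so the identity serves as the isomorphism.
  refine ⟨⟨Equiv.refl (Fin (l + 3)), ?_⟩⟩
  intro a b
  rw [cycle_adj]
  change (SimpleGraph.cycleGraph (l + 1 + 2)).Adj _ _ ↔ _
  rw [SimpleGraph.cycleGraph_adj, or_comm]
  exact or_congr (sub_eq_iff_eq_add.trans ⟨fun h => (h.trans (add_comm _ _)).symm,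
      fun h => h.symm.trans (add_comm _ _)⟩)
    (sub_eq_iff_eq_add.trans ⟨fun h => sub_eq_iff_eq_add.2 (h.trans (add_comm _ _)),
      fun h => (sub_eq_iff_eq_add.1 h).trans (add_comm _ _)⟩)

end Cycle

/-! ### Factors of prescribed order and degree. -/

/-- Cauchy's theorem gives an element of order 2, and -1 is the only one in a field. This is why the
divisors `d` are required to be even: it makes the circulant undirected. -/
theorem neg_one_mem_of_even_card {p : ℕ} [Fact p.Prime] {S : Subgroup (ZMod p)ˣ}
    (h : Even (Nat.card S)) : -1 ∈ S := by
  have : Fact (Nat.Prime 2) := ⟨Nat.prime_two⟩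
  obtain ⟨u, hu⟩ := exists_prime_orderOf_dvd_card' (G := S) 2 (even_iff_two_dvd.1 h)
  have h1 : (u : (ZMod p)ˣ) ≠ 1 := by
    intro h1
    have : u = 1 := Subtype.ext h1
    rw [this, orderOf_one] at hu
    omega
  have h2 : (((u : (ZMod p)ˣ) : ZMod p)) ^ 2 = 1 := by
    have := pow_orderOf_eq_one u
    rw [hu] at this
    simpa using congrArg (fun v : S => ((v : (ZMod p)ˣ) : ZMod p)) this
  rcases mul_self_eq_one_iff.1 ((sq _).symm.trans h2) with h3 | h3
  · exact absurd (Units.ext h3) h1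
  · have : (u : (ZMod p)ˣ) = -1 := Units.ext (by simpa using h3)
    exact this ▸ u.2

theorem exists_subgroup_units_card {p d : ℕ} [Fact p.Prime] (h : d ∣ p - 1) :
    ∃ S : Subgroup (ZMod p)ˣ, Nat.card S = d := by
  obtain ⟨g, hg⟩ := IsCyclic.exists_ofOrder_eq_natCard (α := (ZMod p)ˣ)
  rw [Nat.card_eq_fintype_card, ZMod.card_units] at hg
  obtain ⟨c, hc⟩ := h
  have hp := (Fact.out : p.Prime).two_le
  refine ⟨Subgroup.zpowers (g ^ c), ?_⟩
  have hc0 : c ≠ 0 := by rintro rfl; omega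
  rw [Nat.card_zpowers, orderOf_pow_of_dvd hc0 (hg ▸ hc ▸ dvd_mul_left _ _), hg, hc,
    Nat.mul_div_cancel _ (Nat.pos_of_ne_zero hc0)]

theorem circulant_loopless {p : ℕ} [Fact p.Prime] {S : Subgroup (ZMod p)ˣ} {hS : -1 ∈ S}
    (a : ZMod p) : ¬ (circulant p S hS).Adj a a := by
  rintro ⟨u, -, h⟩
  simp at h

/-- There is a good graph of order `m` and degree `d`, without loops if `P` holds. -/
def ExistsGood (m d : ℕ) (P : Prop) : Prop :=
  ∃ A : LoopGraph (Fin m), A.IsGood d ∧ (P → ∀ v, ¬ A.Adj v v)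

theorem existsGood_of_card {V : Type*} [Fintype V] {A : LoopGraph V} {m d : ℕ} {P : Prop}
    (hV : Fintype.card V = m) (hA : A.IsGood d) (hP : P → ∀ v, ¬ A.Adj v v) :
    ExistsGood m d P := by
  let e : V ≃ Fin m := Fintype.equivFinOfCardEq hV
  let B : LoopGraph (Fin m) :=
    ⟨fun u v => A.Adj (e.symm u) (e.symm v), fun u v => A.symm _ _⟩
  let f : A.Adj ≃r B.Adj := ⟨e, by simp [B]⟩
  exact ⟨B, hA.iso f, fun h v => hP h _⟩

theorem existsGood_loops (m : ℕ) : ExistsGood m 1 False :=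
  ⟨loops _, isGood_loops, False.elim⟩

theorem existsGood_complete {m : ℕ} (hm : 2 ≤ m) : ExistsGood m (m - 1) True := by
  have := isGood_complete (V := Fin m) (by simpa using hm)
  rw [Fintype.card_fin] at this
  exact ⟨complete _, this, fun _ v h => h rfl⟩

theorem existsGood_circulant {p d : ℕ} (hp : p.Prime) (hd : Even d) (h : d ∣ p - 1) :
    ExistsGood p d True := by
  have : Fact p.Prime := ⟨hp⟩
  obtain ⟨S, rfl⟩ := exists_subgroup_units_card h
  exact existsGood_of_card (ZMod.card p)
    (isGood_circulant (hS := neg_one_mem_of_even_card hd) hasTrivialKer_circulant_of_prime)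
    fun _ => circulant_loopless

theorem ExistsGood.mul {a b m n : ℕ} {P Q : Prop} (hA : ExistsGood m a P) (hB : ExistsGood n b Q) :
    ExistsGood (m * n) (a * b) (P ∨ Q) := by
  obtain ⟨A, hA, hP⟩ := hA
  obtain ⟨B, hB, hQ⟩ := hB
  refine existsGood_of_card (by simp) (hA.prod hB) ?_
  rintro (h | h) v hv
  · exact hP h _ hv.1
  · exact hQ h _ hv.2

theorem ExistsGood.mono {m d : ℕ} {P Q : Prop} (h : ExistsGood m d P) (hQ : Q → P) :
    ExistsGood m d Q :=
  ⟨h.choose, h.choose_spec.1, fun hq => h.choose_spec.2 (hQ hq)⟩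

/-- One loopless factor makes the whole product loopless. The empty product is a single looped
vertex, hence the condition `s.Nonempty`. -/
theorem ExistsGood.finset_prod {ι : Type*} {s : Finset ι} {m d : ι → ℕ}
    (h : ∀ i ∈ s, ExistsGood (m i) (d i) True) :
    ExistsGood (∏ i ∈ s, m i) (∏ i ∈ s, d i) s.Nonempty := by
  classical
  induction s using Finset.induction_on with
  | empty => simpa using existsGood_loops 1
  | insert i s hi ih =>
    rw [Finset.prod_insert hi, Finset.prod_insert hi]
    exact ((h i (Finset.mem_insert_self _ _)).mul
      (ih fun j hj => h j (Finset.mem_insert_of_mem hj))).mono fun _ => .inl trivial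

end LoopGraph

end NutGraph

/-! ### The extreme eigenvalues ±d of a connected regular graph. -/

namespace NutGraph

namespace LoopGraph

variable {V W : Type*} [Fintype V] [Fintype W]

/-- For s = ±1 and an eigenvector for -sd, the nonnegative sum of (h v + s·h w)² over all arcs
expands to zero, so every term vanishes. -/
theorem HasDegree.add_mul_eq_zero {A : LoopGraph V} {d : ℕ} (hA : A.HasDegree d) {s : ℝ}
    (hs : s ^ 2 = 1) {h : V → ℝ} (hh : ∀ v, ∑ w, A.adjMatrix v w * h w = -s * d * h v) {v w : V}
    (hvw : A.Adj v w) : h v + s * h w = 0 := by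
  have hnonneg : ∀ v w, 0 ≤ A.adjMatrix v w * (h v + s * h w) ^ 2 := fun v w => by
    refine mul_nonneg ?_ (sq_nonneg _)
    by_cases h : A.Adj v w
    · rw [adjMatrix_of_adj h]; exact zero_le_one
    · rw [adjMatrix_of_not_adj h]
  have h1 : ∑ v, ∑ w, A.adjMatrix v w * h v ^ 2 = ∑ v, d * h v ^ 2 :=
    Finset.sum_congr rfl fun v _ => by rw [← Finset.sum_mul, hA v]
  have h2 : ∑ v, ∑ w, A.adjMatrix v w * h w ^ 2 = ∑ v, d * h v ^ 2 := by
    rw [Finset.sum_comm, ← h1]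
    exact Finset.sum_congr rfl fun v _ => Finset.sum_congr rfl fun w _ => by rw [adjMatrix_comm]
  have h3 : ∑ v, ∑ w, A.adjMatrix v w * (h v * h w) = ∑ v, -s * (d * h v ^ 2) :=
    Finset.sum_congr rfl fun v _ => by
      rw [Finset.sum_congr rfl fun w _ => mul_left_comm _ _ _, ← Finset.mul_sum, hh v]
      ring
  have hsum : ∑ v, ∑ w, A.adjMatrix v w * (h v + s * h w) ^ 2 = 0 := by
    have : ∀ v w, A.adjMatrix v w * (h v + s * h w) ^ 2 = A.adjMatrix v w * h v ^ 2
        + 2 * s * (A.adjMatrix v w * (h v * h w)) + A.adjMatrix v w * h w ^ 2 := fun v w => by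
      linear_combination A.adjMatrix v w * h w ^ 2 * hs
    simp only [this, Finset.sum_add_distrib, h1, h2, ← Finset.mul_sum, h3]
    linear_combination (-2 * (d * ∑ v, h v ^ 2)) * hs
  have h4 := (Finset.sum_eq_zero_iff_of_nonneg fun v _ =>
    Finset.sum_nonneg fun w _ => hnonneg v w).1 hsum v (Finset.mem_univ _)
  have h5 := (Finset.sum_eq_zero_iff_of_nonneg fun w _ => hnonneg v w).1 h4 w (Finset.mem_univ _)
  rw [adjMatrix_of_adj hvw, one_mul] at h5
  exact pow_eq_zero_iff two_ne_zero |>.1 h5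

theorem _root_.SimpleGraph.Connected.eq_of_forall_adj {V : Type*} {Γ : SimpleGraph V} {β : Type*}
    (hΓ : Γ.Connected) {f : V → β} (hf : ∀ u v, Γ.Adj u v → f u = f v) (u v : V) : f u = f v := by
  obtain ⟨p⟩ := hΓ.preconnected u v
  induction p with
  | nil => rfl
  | cons h _ ih => exact (hf _ _ h).trans ih

section Regular

variable {Γ : SimpleGraph V} {d : ℕ}

theorem eq_of_eigenvalue_degree (hΓ : Γ.Connected) (hd : (ofSimple Γ).HasDegree d) {h : V → ℝ}
    (hh : ∀ v, ∑ w, (ofSimple Γ).adjMatrix v w * h w = d * h v) (u v : V) : h u = h v := by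
  refine hΓ.eq_of_forall_adj (fun u v huv => ?_) u v
  have := hd.add_mul_eq_zero (s := -1) (by norm_num) (h := h) (fun v => by rw [hh]; ring)
    (show (ofSimple Γ).Adj u v from huv)
  linarith

/-- Such an eigenvector flips sign along each edge, so its absolute value is constant. Its entries
also sum to zero, by regularity, and an odd number of values ±c cannot do so unless c = 0. -/
theorem eq_zero_of_eigenvalue_neg_degree (hΓ : Γ.Connected) (hd : (ofSimple Γ).HasDegree d)
    (hd0 : d ≠ 0) (hodd : Odd (Fintype.card V)) {h : V → ℝ}
    (hh : ∀ v, ∑ w, (ofSimple Γ).adjMatrix v w * h w = -d * h v) (v : V) : h v = 0 := by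
  classical
  have hsq : ∀ u, h u ^ 2 = h v ^ 2 := by
    intro u
    refine hΓ.eq_of_forall_adj (f := fun u => h u ^ 2) (fun u v huv => ?_) u v
    have := hd.add_mul_eq_zero (s := 1) (by norm_num) (h := h) (fun v => by rw [hh]; ring)
      (show (ofSimple Γ).Adj u v from huv)
    have : h u = -h v := by linarith
    simp [this]
  have hsum : ∑ u, h u = 0 := by
    have h1 : ∑ u, ∑ w, (ofSimple Γ).adjMatrix u w * h w = d * ∑ w, h w := by
      rw [Finset.sum_comm, Finset.mul_sum]
      refine Finset.sum_congr rfl fun w _ => ?_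
      rw [← Finset.sum_mul, ← hd w]
      simp only [adjMatrix_comm _ w]
    simp only [hh, ← Finset.mul_sum] at h1
    have hd' : (d : ℝ) ≠ 0 := by exact_mod_cast hd0
    have : (d : ℝ) * ∑ w, h w = 0 := by linarith
    exact (mul_eq_zero.1 this).resolve_left hd'
  have hsign : ∀ u, h u = h v * (2 * (if h u = h v then 1 else 0) - 1) := by
    intro u
    split_ifs with hu
    · rw [hu]; ring
    · rw [(sq_eq_sq_iff_eq_or_eq_neg.1 (hsq u)).resolve_left hu]; ring
  rw [Finset.sum_congr rfl fun u _ => hsign u, ← Finset.mul_sum, Finset.sum_sub_distrib,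
    ← Finset.mul_sum, Finset.sum_boole] at hsum
  refine (mul_eq_zero.1 hsum).resolve_right fun h0 => ?_
  simp only [Finset.sum_const, Finset.card_univ, nsmul_eq_mul, mul_one] at h0
  have : 2 * (Finset.univ.filter fun u => h u = h v).card = Fintype.card V := by
    have := sub_eq_zero.1 h0
    exact_mod_cast this
  exact Nat.not_odd_iff_even.2 ⟨_, (this ▸ two_mul _)⟩ hodd

/-- Factor A² - d² = (A + d)(A - d): the vector (A - d)h belongs to the eigenvalue -d, so it is
zero. -/
theorem eq_of_sq_eigenvalue (hΓ : Γ.Connected) (hd : (ofSimple Γ).HasDegree d) (hd0 : d ≠ 0)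
    (hodd : Odd (Fintype.card V)) {h : V → ℝ}
    (hh : ∀ v, ∑ w, (ofSimple Γ).adjMatrix v w * ∑ u, (ofSimple Γ).adjMatrix w u * h u
      = d ^ 2 * h v) (u v : V) : h u = h v := by
  refine eq_of_eigenvalue_degree hΓ hd (fun v => sub_eq_zero.1 ?_) u v
  refine eq_zero_of_eigenvalue_neg_degree hΓ hd hd0 hodd
    (h := fun v => ∑ w, (ofSimple Γ).adjMatrix v w * h w - d * h v) (fun v => ?_) v
  simp only [mul_sub, Finset.sum_sub_distrib, hh v, mul_left_comm _ (d : ℝ), ← Finset.mul_sum]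
  ring

end Regular

/-- Solve dAh = c on the first factor. As `B` has constant row sums d, the pullback of h solves the
system on the product, where solutions are unique. -/
theorem exists_eq_comp_fst {A : LoopGraph V} {B : LoopGraph W} {d : ℕ} (hA : A.HasTrivialKer)
    (hB : B.HasTrivialKer) (hd : B.HasDegree d) (hd0 : d ≠ 0) {x : V × W → ℝ} {c : V → ℝ}
    (hx : ∀ p, ∑ q, (A.prod B).adjMatrix p q * x q = c p.1) :
    ∃ h : V → ℝ, (∀ p, x p = h p.1) ∧ ∀ v, d * ∑ w, A.adjMatrix v w * h w = c v := by
  have hd' : (d : ℝ) ≠ 0 := by exact_mod_cast hd0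
  obtain ⟨h, hh⟩ := hA.exists_preimage fun v => (d : ℝ)⁻¹ * c v
  have hc : ∀ v, d * ∑ w, A.adjMatrix v w * h w = c v := fun v => by
    rw [hh, mul_inv_cancel_left₀ hd']
  refine ⟨h, fun p => ?_, hc⟩
  refine sub_eq_zero.1 ((hA.prod hB) (fun p => x p - h p.1) (fun p => ?_) p)
  simp only [mul_sub, Finset.sum_sub_distrib, hx p]
  rw [sub_eq_zero, ← hc, Fintype.sum_prod_type, Finset.mul_sum]
  refine Finset.sum_congr rfl fun v _ => ?_
  simp only [adjMatrix_prod]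
  rw [← Finset.sum_mul, ← Finset.mul_sum, hd p.2]
  ring

end LoopGraph

end NutGraph

/-! ### Criteria for being a nut graph and for counting orbits. -/

namespace NutGraph

open LoopGraph

section Criteria

variable {V : Type*}

theorem adjMatrix_ofSimple (Γ : SimpleGraph V) [DecidableRel Γ.Adj] :
    (ofSimple Γ).adjMatrix = Γ.adjMatrix ℝ := by
  ext u v
  by_cases h : Γ.Adj u v <;>
    simp [LoopGraph.adjMatrix, ofSimple, SimpleGraph.adjMatrix_apply, h]

theorem isNut_of_forall [Fintype V] [Nonempty V] {Γ : SimpleGraph V} {x : V → ℝ}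
    (hx0 : ∀ v, x v ≠ 0) (hx : ∀ v, ∑ w, (ofSimple Γ).adjMatrix v w * x w = 0)
    (h : ∀ y : V → ℝ, (∀ v, ∑ w, (ofSimple Γ).adjMatrix v w * y w = 0) →
      ∃ c : ℝ, ∀ v, y v = c * x v) : IsNut Γ := by
  classical
  have hker : LinearMap.ker (Matrix.toLin' (Γ.adjMatrix ℝ)) = Submodule.span ℝ {x} := by
    ext y
    rw [LinearMap.mem_ker, Matrix.toLin'_apply, Submodule.mem_span_singleton,
      ← adjMatrix_ofSimple]
    constructor
    · intro hy
      obtain ⟨c, hc⟩ := h y fun v => congrFun hy v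
      exact ⟨c, funext fun v => (hc v).symm⟩
    · rintro ⟨c, rfl⟩
      rw [Matrix.mulVec_smul]
      have : (ofSimple Γ).adjMatrix.mulVec x = 0 := funext hx
      rw [this, smul_zero]
  have hx1 : x ≠ 0 := fun h => hx0 (Classical.arbitrary V) (congrFun h _)
  have hmain : Module.finrank ℝ (LinearMap.ker (Matrix.toLin' (Γ.adjMatrix ℝ))) = 1 := by
    rw [hker, finrank_span_singleton hx1]
  refine ⟨?_, x, hx0, ?_⟩
  · convert hmain
  · convert hker

/-- Orbits are counted by the values of a complete invariant: the side for vertices, the unordered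
pair of sides for edges. -/
theorem ncard_orbits {α β : Type*} {s : Set α} {R : α → α → Prop} (c : α → β)
    (h : ∀ a ∈ s, ∀ b, R a b ↔ b ∈ s ∧ c a = c b) :
    {O : Set α | ∃ a ∈ s, O = {b | R a b}}.ncard = (c '' s).ncard := by
  have himg : {O : Set α | ∃ a ∈ s, O = {b | R a b}} =
      (fun y => {b | b ∈ s ∧ y = c b}) '' (c '' s) := by
    ext O
    constructor
    · rintro ⟨a, ha, rfl⟩
      exact ⟨c a, ⟨a, ha, rfl⟩, by ext b; exact (h a ha b).symm⟩
    · rintro ⟨_, ⟨a, ha, rfl⟩, rfl⟩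
      exact ⟨a, ha, by ext b; exact (h a ha b).symm⟩
  rw [himg]
  refine Set.InjOn.ncard_image ?_
  rintro _ ⟨a, ha, rfl⟩ y _ hy
  have : a ∈ {b | b ∈ s ∧ c a = c b} := ⟨ha, rfl⟩
  exact ((Set.ext_iff.1 hy a).1 this).2.symm

variable {Γ : SimpleGraph V} {side : V → Bool}

theorem numVertexOrbits_eq_two (hinv : ∀ (φ : Γ ≃g Γ) v, side (φ v) = side v)
    (htrans : ∀ v w, side v = side w → ∃ φ : Γ ≃g Γ, φ v = w) (hsurj : Function.Surjective side) :
    numVertexOrbits Γ = 2 := by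
  have h := ncard_orbits (s := Set.univ) (R := fun v w => ∃ φ : Γ ≃g Γ, φ v = w) side (by
    intro v _ w
    constructor
    · rintro ⟨φ, rfl⟩
      exact ⟨trivial, (hinv φ v).symm⟩
    · exact fun h => htrans v w h.2)
  rw [Set.image_univ, hsurj.range_eq, Set.ncard_univ, Nat.card_eq_fintype_card,
    Fintype.card_bool] at h
  simpa [numVertexOrbits] using h

theorem numEdgeOrbits_eq_three (hinv : ∀ (φ : Γ ≃g Γ) v, side (φ v) = side v)
    (htrans : ∀ u v u' v', Γ.Adj u v → Γ.Adj u' v' → side u = side u' → side v = side v' →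
      ∃ φ : Γ ≃g Γ, φ u = u' ∧ φ v = v')
    (hsurj : ∀ a b, ∃ u v, Γ.Adj u v ∧ side u = a ∧ side v = b) :
    numEdgeOrbits Γ = 3 := by
  have h := ncard_orbits (s := Γ.edgeSet) (R := fun e f => ∃ φ : Γ ≃g Γ, Sym2.map φ e = f)
    (Sym2.map side) (by
    intro e he f
    induction e using Sym2.ind with
    | _ u v =>
    constructor
    · rintro ⟨φ, rfl⟩
      rw [Sym2.map_mk, Sym2.map_mk, Sym2.map_mk, hinv, hinv]
      exact ⟨φ.map_rel_iff.2 he, rfl⟩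
    · induction f using Sym2.ind with
      | _ u' v' =>
      rintro ⟨hf, h⟩
      rw [Sym2.map_mk, Sym2.map_mk, Sym2.eq_iff] at h
      rcases h with h | h
      · obtain ⟨φ, h1, h2⟩ := htrans u v u' v' he hf h.1 h.2
        exact ⟨φ, by rw [Sym2.map_mk, h1, h2]⟩
      · obtain ⟨φ, h1, h2⟩ := htrans u v v' u' he (SimpleGraph.Adj.symm hf) h.1 h.2
        exact ⟨φ, by rw [Sym2.map_mk, h1, h2, Sym2.eq_swap]⟩)
  have himg : Sym2.map side '' Γ.edgeSet = Set.univ := by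
    refine Set.eq_univ_of_forall fun e => ?_
    induction e using Sym2.ind with
    | _ a b =>
    obtain ⟨u, v, huv, rfl, rfl⟩ := hsurj a b
    exact ⟨s(u, v), huv, rfl⟩
  have hcard : Fintype.card (Sym2 Bool) = 3 := by rw [Sym2.card]; rfl
  rw [himg, Set.ncard_univ, Nat.card_eq_fintype_card, hcard] at h
  exact h

end Criteria

/-! ### The merged graph: automorphisms, degrees and null space. -/

section Merge

variable {X Y Z : Type*} {Λ₁ Λ₂ : LoopGraph X} {Λ₄ : LoopGraph Y} {Λ₅ : LoopGraph Z}

/-- Automorphisms of the factors act on the merged graph. -/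
def mergeAut (φ : Λ₁.Adj ≃r Λ₁.Adj) (hφ : ∀ u v, Λ₂.Adj (φ u) (φ v) ↔ Λ₂.Adj u v)
    (ψ : Λ₄.Adj ≃r Λ₄.Adj) (θ : Λ₅.Adj ≃r Λ₅.Adj) :
    (merge Λ₁ Λ₂ Λ₄ Λ₅).Adj ≃r (merge Λ₁ Λ₂ Λ₄ Λ₅).Adj where
  toEquiv := Equiv.sumCongr (φ.toEquiv.prodCongr ψ.toEquiv) (φ.toEquiv.prodCongr θ.toEquiv)
  map_rel_iff' := by
    rintro (u | u) (v | v)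
    · exact and_congr φ.map_rel_iff ψ.map_rel_iff
    · exact φ.injective.eq_iff
    · exact φ.injective.eq_iff
    · exact and_congr (hφ _ _) θ.map_rel_iff

/-- The cross edges force one automorphism to act on both copies of `X`. Hence `harc₂` moves the
arcs of `Λ₂` by automorphisms of `Λ₁`; when `Λ₂` consists of loops this is vertex-transitivity of
`Λ₁`. -/
theorem exists_mergeAut_arc
    (hpres : ∀ (φ : Λ₁.Adj ≃r Λ₁.Adj) u v, Λ₂.Adj (φ u) (φ v) ↔ Λ₂.Adj u v)
    (harc₁ : Λ₁.IsArcTransitive)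
    (harc₂ : ∀ u v u' v', Λ₂.Adj u v → Λ₂.Adj u' v' → ∃ φ : Λ₁.Adj ≃r Λ₁.Adj, φ u = u' ∧ φ v = v')
    (htrans₁ : ∀ u v : X, ∃ φ : Λ₁.Adj ≃r Λ₁.Adj, φ u = v)
    (harc₄ : Λ₄.IsArcTransitive) (htrans₄ : ∀ u v : Y, ∃ φ : Λ₄.Adj ≃r Λ₄.Adj, φ u = v)
    (harc₅ : Λ₅.IsArcTransitive) (htrans₅ : ∀ u v : Z, ∃ φ : Λ₅.Adj ≃r Λ₅.Adj, φ u = v)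
    (u v u' v' : (X × Y) ⊕ (X × Z)) (h : (merge Λ₁ Λ₂ Λ₄ Λ₅).Adj u v)
    (h' : (merge Λ₁ Λ₂ Λ₄ Λ₅).Adj u' v') (hu : u.isLeft = u'.isLeft) (hv : v.isLeft = v'.isLeft) :
    ∃ ψ : (merge Λ₁ Λ₂ Λ₄ Λ₅).Adj ≃r (merge Λ₁ Λ₂ Λ₄ Λ₅).Adj, ψ u = u' ∧ ψ v = v' := by
  rcases u with ⟨i, j⟩ | ⟨i, j⟩ <;> rcases u' with ⟨i', j'⟩ | ⟨i', j'⟩ <;>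
    try (simp at hu; done)
  · rcases v with ⟨k, l⟩ | ⟨k, l⟩ <;> rcases v' with ⟨k', l'⟩ | ⟨k', l'⟩ <;>
      try (simp at hv; done)
    · obtain ⟨φ, h1, h2⟩ := harc₁ _ _ _ _ h.1 h'.1
      obtain ⟨ψ, h3, h4⟩ := harc₄ _ _ _ _ h.2 h'.2
      exact ⟨mergeAut φ (hpres φ) ψ (RelIso.refl _), congrArg Sum.inl (Prod.ext h1 h3),
        congrArg Sum.inl (Prod.ext h2 h4)⟩
    · obtain ⟨φ, h1⟩ := htrans₁ i i'
      obtain ⟨ψ, h2⟩ := htrans₄ j j'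
      obtain ⟨θ, h3⟩ := htrans₅ l l'
      cases (show i = k from h)
      cases (show i' = k' from h')
      exact ⟨mergeAut φ (hpres φ) ψ θ, congrArg Sum.inl (Prod.ext h1 h2),
        congrArg Sum.inr (Prod.ext h1 h3)⟩
  · rcases v with ⟨k, l⟩ | ⟨k, l⟩ <;> rcases v' with ⟨k', l'⟩ | ⟨k', l'⟩ <;>
      try (simp at hv; done)
    · obtain ⟨φ, h1⟩ := htrans₁ i i'
      obtain ⟨ψ, h2⟩ := htrans₄ l l'
      obtain ⟨θ, h3⟩ := htrans₅ j j'
      cases (show i = k from h)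
      cases (show i' = k' from h')
      exact ⟨mergeAut φ (hpres φ) ψ θ, congrArg Sum.inr (Prod.ext h1 h3),
        congrArg Sum.inl (Prod.ext h1 h2)⟩
    · obtain ⟨φ, h1, h2⟩ := harc₂ _ _ _ _ h.1 h'.1
      obtain ⟨θ, h3, h4⟩ := harc₅ _ _ _ _ h.2 h'.2
      exact ⟨mergeAut φ (hpres φ) (RelIso.refl _) θ, congrArg Sum.inr (Prod.ext h1 h3),
        congrArg Sum.inr (Prod.ext h2 h4)⟩

theorem exists_mergeAut_vertex
    (hpres : ∀ (φ : Λ₁.Adj ≃r Λ₁.Adj) u v, Λ₂.Adj (φ u) (φ v) ↔ Λ₂.Adj u v)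
    (htrans₁ : ∀ u v : X, ∃ φ : Λ₁.Adj ≃r Λ₁.Adj, φ u = v)
    (htrans₄ : ∀ u v : Y, ∃ φ : Λ₄.Adj ≃r Λ₄.Adj, φ u = v)
    (htrans₅ : ∀ u v : Z, ∃ φ : Λ₅.Adj ≃r Λ₅.Adj, φ u = v)
    (u u' : (X × Y) ⊕ (X × Z)) (hu : u.isLeft = u'.isLeft) :
    ∃ ψ : (merge Λ₁ Λ₂ Λ₄ Λ₅).Adj ≃r (merge Λ₁ Λ₂ Λ₄ Λ₅).Adj, ψ u = u' := by
  rcases u with ⟨i, j⟩ | ⟨i, j⟩ <;> rcases u' with ⟨i', j'⟩ | ⟨i', j'⟩ <;>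
    try (simp at hu; done)
  · obtain ⟨φ, h1⟩ := htrans₁ i i'
    obtain ⟨ψ, h2⟩ := htrans₄ j j'
    exact ⟨mergeAut φ (hpres φ) ψ (RelIso.refl _), congrArg Sum.inl (Prod.ext h1 h2)⟩
  · obtain ⟨φ, h1⟩ := htrans₁ i i'
    obtain ⟨θ, h2⟩ := htrans₅ j j'
    exact ⟨mergeAut φ (hpres φ) (RelIso.refl _) θ, congrArg Sum.inr (Prod.ext h1 h2)⟩

variable [Fintype X] [Fintype Y] [Fintype Z]

theorem sum_adjMatrix_merge_inl (p : X × Y) (f : (X × Y) ⊕ (X × Z) → ℝ) :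
    ∑ w, (merge Λ₁ Λ₂ Λ₄ Λ₅).adjMatrix (.inl p) w * f w =
      ∑ q, (Λ₁.prod Λ₄).adjMatrix p q * f (.inl q) + ∑ z, f (.inr (p.1, z)) := by
  classical
  rw [Fintype.sum_sum_type]
  congr 1
  rw [Fintype.sum_prod_type, Finset.sum_eq_single p.1]
  · refine Finset.sum_congr rfl fun z _ => ?_
    rw [adjMatrix_of_adj (show (merge Λ₁ Λ₂ Λ₄ Λ₅).Adj (.inl p) (.inr (p.1, z)) from rfl), one_mul]
  · intro x _ hx
    refine Finset.sum_eq_zero fun z _ => ?_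
    rw [adjMatrix_of_not_adj (fun h : p.1 = x => hx h.symm), zero_mul]
  · simp

theorem sum_adjMatrix_merge_inr (p : X × Z) (f : (X × Y) ⊕ (X × Z) → ℝ) :
    ∑ w, (merge Λ₁ Λ₂ Λ₄ Λ₅).adjMatrix (.inr p) w * f w =
      ∑ q, (Λ₂.prod Λ₅).adjMatrix p q * f (.inr q) + ∑ y, f (.inl (p.1, y)) := by
  classical
  rw [Fintype.sum_sum_type, add_comm]
  congr 1
  rw [Fintype.sum_prod_type, Finset.sum_eq_single p.1]
  · refine Finset.sum_congr rfl fun z _ => ?_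
    rw [adjMatrix_of_adj (show (merge Λ₁ Λ₂ Λ₄ Λ₅).Adj (.inr p) (.inl (p.1, z)) from rfl), one_mul]
  · intro x _ hx
    refine Finset.sum_eq_zero fun z _ => ?_
    rw [adjMatrix_of_not_adj (fun h : p.1 = x => hx h.symm), zero_mul]
  · simp

variable {a b d₄ d₅ : ℕ}

theorem sum_adjMatrix_merge_inl_const (h₁ : Λ₁.HasDegree a) (h₄ : Λ₄.HasDegree d₄) (p : X × Y)
    (r s : ℝ) :
    ∑ w, (merge Λ₁ Λ₂ Λ₄ Λ₅).adjMatrix (.inl p) w * Sum.elim (fun _ => r) (fun _ => s) w =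
      a * d₄ * r + Fintype.card Z * s := by
  rw [sum_adjMatrix_merge_inl]
  simp only [Sum.elim_inl, Sum.elim_inr, ← Finset.sum_mul, (h₁.prod h₄) p]
  simp

theorem sum_adjMatrix_merge_inr_const (h₂ : Λ₂.HasDegree b) (h₅ : Λ₅.HasDegree d₅) (p : X × Z)
    (r s : ℝ) :
    ∑ w, (merge Λ₁ Λ₂ Λ₄ Λ₅).adjMatrix (.inr p) w * Sum.elim (fun _ => r) (fun _ => s) w =
      b * d₅ * s + Fintype.card Y * r := by
  rw [sum_adjMatrix_merge_inr]
  simp only [Sum.elim_inl, Sum.elim_inr, ← Finset.sum_mul, (h₂.prod h₅) p]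
  simp

/-- Automorphisms preserve row sums, and `hne` says that these differ on the two sides. -/
theorem isLeft_mergeAut (h₁ : Λ₁.HasDegree a) (h₂ : Λ₂.HasDegree b) (h₄ : Λ₄.HasDegree d₄)
    (h₅ : Λ₅.HasDegree d₅) (hne : a * d₄ + Fintype.card Z ≠ b * d₅ + Fintype.card Y)
    (φ : (merge Λ₁ Λ₂ Λ₄ Λ₅).Adj ≃r (merge Λ₁ Λ₂ Λ₄ Λ₅).Adj) (v : (X × Y) ⊕ (X × Z)) :
    (φ v).isLeft = v.isLeft := by
  have hconst : Sum.elim (fun _ : X × Y => (1 : ℝ)) (fun _ : X × Z => 1) = fun _ => 1 := by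
    ext (w | w) <;> rfl
  have hdeg : ∑ w, (merge Λ₁ Λ₂ Λ₄ Λ₅).adjMatrix (φ v) w * 1 =
      ∑ w, (merge Λ₁ Λ₂ Λ₄ Λ₅).adjMatrix v w * 1 := by
    rw [← φ.toEquiv.sum_comp]
    exact Finset.sum_congr rfl fun w _ => congrArg (· * _) (adjMatrix_iso φ v w)
  have hl := fun p => sum_adjMatrix_merge_inl_const (Λ₂ := Λ₂) (Λ₅ := Λ₅) h₁ h₄ p 1 1
  have hr := fun p => sum_adjMatrix_merge_inr_const (Λ₁ := Λ₁) (Λ₄ := Λ₄) h₂ h₅ p 1 1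
  rw [hconst] at hl hr
  rcases v with v | v
  · rcases hw : φ (.inl v) with w | w
    · rfl
    · rw [hw, hr, hl] at hdeg
      simp only [mul_one] at hdeg
      exact absurd (by exact_mod_cast hdeg.symm) hne
  · rcases hw : φ (.inr v) with w | w
    · rw [hw, hr, hl] at hdeg
      simp only [mul_one] at hdeg
      exact absurd (by exact_mod_cast hdeg) hne
    · rfl

theorem exists_eq_mul_of_merge_ker {Λ : SimpleGraph X} (h₁ : (ofSimple Λ).IsGood a)
    (hconn : Λ.Connected) (hodd : Odd (Fintype.card X)) (h₂ : Λ₂.IsGood b)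
    (hΛ₂ : Λ₂ = loops X ∨ Λ₂ = ofSimple Λ) (h₄ : Λ₄.IsGood d₄) (h₅ : Λ₅.IsGood d₅)
    (ha : a ≠ 0) (hb : b ≠ 0) (hd₄ : d₄ ≠ 0) (hd₅ : d₅ ≠ 0)
    (hprod : a * b * d₄ * d₅ = Fintype.card Y * Fintype.card Z)
    {f : (X × Y) ⊕ (X × Z) → ℝ}
    (hf : ∀ v, ∑ w, (merge (ofSimple Λ) Λ₂ Λ₄ Λ₅).adjMatrix v w * f w = 0) :
    ∃ c : ℝ, ∀ v, f v = c * Sum.elim (fun _ : X × Y => (Fintype.card Z : ℝ))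
      (fun _ : X × Z => -(a * d₄ : ℝ)) v := by
  have hY : (Fintype.card Y : ℝ) ≠ 0 := by
    intro h
    have h' : Fintype.card Y = 0 := by exact_mod_cast h
    rw [h', zero_mul] at hprod
    simp [ha, hb, hd₄, hd₅] at hprod
  have hZ : (Fintype.card Z : ℝ) ≠ 0 := by
    intro h
    have h' : Fintype.card Z = 0 := by exact_mod_cast h
    rw [h', mul_zero] at hprod
    simp [ha, hb, hd₄, hd₅] at hprod
  have hprod' : (a * b * d₄ * d₅ : ℝ) = Fintype.card Y * Fintype.card Z := by exact_mod_cast hprod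
  have ha' : (a : ℝ) ≠ 0 := by exact_mod_cast ha
  have hd₄' : (d₄ : ℝ) ≠ 0 := by exact_mod_cast hd₄
  have hd₅' : (d₅ : ℝ) ≠ 0 := by exact_mod_cast hd₅
  obtain ⟨h, hh, hh'⟩ := exists_eq_comp_fst h₁.trivialKer h₄.trivialKer h₄.degree hd₄
    (x := fun q => f (.inl q)) (c := fun i => -∑ z, f (.inr (i, z))) fun p => by
      have := hf (.inl p)
      rw [sum_adjMatrix_merge_inl] at this
      linarith
  obtain ⟨k, hk, hk'⟩ := exists_eq_comp_fst h₂.trivialKer h₅.trivialKer h₅.degree hd₅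
    (x := fun q => f (.inr q)) (c := fun i => -∑ y, f (.inl (i, y))) fun p => by
      have := hf (.inr p)
      rw [sum_adjMatrix_merge_inr] at this
      linarith
  simp only [hh, hk, Finset.sum_const, Finset.card_univ, nsmul_eq_mul] at hh' hk'
  have hconst : ∀ u v, h u = h v := by
    rcases hΛ₂ with rfl | rfl
    · classical
      have hb1 : b = 1 := by
        obtain ⟨v⟩ := hconn.nonempty
        have h3 := h₂.degree v
        have h4 := (isGood_loops (V := X)).degree v
        exact_mod_cast h3.symm.trans h4
      subst hb1
      simp only [adjMatrix_loops, ite_mul, one_mul, zero_mul, Finset.sum_ite_eq, Finset.mem_univ,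
        if_true] at hk'
      refine eq_of_eigenvalue_degree hconn h₁.degree fun v => ?_
      refine mul_left_cancel₀ (mul_ne_zero hd₅' hd₄') ?_
      push_cast at hprod'
      -- Eliminating `k` leaves Ah = a·h, since d₄d₅a = |Y||Z|.
      linear_combination d₅ * hh' v - (Fintype.card Z : ℝ) * hk' v - h v * hprod'
    · have hba : b = a := by
        obtain ⟨v⟩ := hconn.nonempty
        exact_mod_cast (h₂.degree v).symm.trans (h₁.degree v)
      subst hba
      refine eq_of_sq_eigenvalue hconn h₁.degree ha hodd fun v => ?_
      refine mul_left_cancel₀ (mul_ne_zero hd₅' hd₄') ?_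
      -- The adjacency operator applied to `hh'`, so that `hk'` can eliminate `k` and leave A²h =
      -- a²h.
      have h3 : (d₄ : ℝ) * ∑ w, (ofSimple Λ).adjMatrix v w * ∑ u, (ofSimple Λ).adjMatrix w u * h u =
          -(Fintype.card Z) * ∑ w, (ofSimple Λ).adjMatrix v w * k w := by
        rw [Finset.mul_sum, Finset.mul_sum]
        refine Finset.sum_congr rfl fun w _ => ?_
        linear_combination (ofSimple Λ).adjMatrix v w * hh' w
      linear_combination d₅ * h3 - (Fintype.card Z : ℝ) * hk' v - h v * hprod'
  obtain ⟨v₀⟩ := hconn.nonempty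
  refine ⟨h v₀ / Fintype.card Z, ?_⟩
  rintro (p | p)
  · rw [Sum.elim_inl, hh p, hconst p.1 v₀, div_mul_cancel₀ _ hZ]
  · rw [Sum.elim_inr, hk p]
    have h3 := hh' p.1
    rw [Finset.sum_congr rfl fun w _ => by rw [hconst w v₀], ← Finset.sum_mul, h₁.degree] at h3
    field_simp
    linear_combination h3

theorem isNutTwoThree_of_iso_merge {V : Type*} [Fintype V] {Γ : SimpleGraph V} {Λ : SimpleGraph X}
    (e : Γ.Adj ≃r (merge (ofSimple Λ) Λ₂ Λ₄ Λ₅).Adj) (h₁ : (ofSimple Λ).IsGood a)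
    (hconn : Λ.Connected) (hodd : Odd (Fintype.card X)) (h₂ : Λ₂.IsGood b)
    (hΛ₂ : Λ₂ = loops X ∨ Λ₂ = ofSimple Λ) (h₄ : Λ₄.IsGood d₄) (h₅ : Λ₅.IsGood d₅)
    (ha : a ≠ 0) (hb : b ≠ 0) (hd₄ : d₄ ≠ 0) (hd₅ : d₅ ≠ 0)
    (hprod : a * b * d₄ * d₅ = Fintype.card Y * Fintype.card Z)
    (hne : a * d₄ + Fintype.card Z ≠ b * d₅ + Fintype.card Y) : IsNutTwoThree Γ := by
  have hYZ : Fintype.card Y ≠ 0 ∧ Fintype.card Z ≠ 0 := by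
    rw [← mul_ne_zero_iff, ← hprod]
    simp [ha, hb, hd₄, hd₅]
  obtain ⟨i⟩ := hconn.nonempty
  obtain ⟨y⟩ := Fintype.card_pos_iff.1 (Nat.pos_of_ne_zero hYZ.1)
  obtain ⟨z⟩ := Fintype.card_pos_iff.1 (Nat.pos_of_ne_zero hYZ.2)
  have : Nonempty V := ⟨e.symm (.inl (i, y))⟩
  have hpres : ∀ (φ : (ofSimple Λ).Adj ≃r (ofSimple Λ).Adj) u v,
      Λ₂.Adj (φ u) (φ v) ↔ Λ₂.Adj u v := by
    rcases hΛ₂ with rfl | rfl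
    · exact fun φ u v => φ.injective.eq_iff
    · exact fun φ u v => φ.map_rel_iff
  have harc₂ : ∀ u v u' v', Λ₂.Adj u v → Λ₂.Adj u' v' →
      ∃ φ : (ofSimple Λ).Adj ≃r (ofSimple Λ).Adj, φ u = u' ∧ φ v = v' := by
    rcases hΛ₂ with rfl | rfl
    · rintro u _ u' _ rfl rfl
      obtain ⟨φ, h⟩ := h₁.vertexTransitive u u'
      exact ⟨φ, h, h⟩
    · exact h₁.arcTransitive
  have hsum : ∀ (f : V → ℝ) v, ∑ w, (ofSimple Γ).adjMatrix v w * f w =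
      ∑ w, (merge (ofSimple Λ) Λ₂ Λ₄ Λ₅).adjMatrix (e v) w * f (e.symm w) := by
    intro f v
    rw [← e.toEquiv.sum_comp]
    refine Finset.sum_congr rfl fun w _ => ?_
    have h3 := adjMatrix_iso (A := ofSimple Γ) e v w
    have h4 : e.symm (e w) = w := e.symm_apply_apply w
    change _ = _ * f (e.symm (e w))
    rw [h4, ← h3]
    rfl
  refine ⟨?_, ?_, ?_⟩
  · refine isNut_of_forall (x := fun v => Sum.elim (fun _ : X × Y => (Fintype.card Z : ℝ))
      (fun _ : X × Z => -(a * d₄ : ℝ)) (e v)) ?_ ?_ ?_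
    · intro v
      rcases e v with w | w
      · rw [Sum.elim_inl]
        exact_mod_cast hYZ.2
      · rw [Sum.elim_inr]
        refine neg_ne_zero.2 ?_
        exact_mod_cast mul_ne_zero ha hd₄
    · intro v
      rw [hsum]
      simp only [RelIso.apply_symm_apply]
      rcases e v with w | w
      · rw [sum_adjMatrix_merge_inl_const h₁.degree h₄.degree]
        ring
      · rw [sum_adjMatrix_merge_inr_const h₂.degree h₅.degree]
        have hprod' : (a * b * d₄ * d₅ : ℝ) = Fintype.card Y * Fintype.card Z := by
          exact_mod_cast hprod
        linear_combination -hprod'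
    · intro f hf
      obtain ⟨c, hc⟩ := exists_eq_mul_of_merge_ker h₁ hconn hodd h₂ hΛ₂ h₄ h₅ ha hb hd₄ hd₅ hprod
        (f := fun w => f (e.symm w)) fun w => by
          rw [← hf (e.symm w), hsum, RelIso.apply_symm_apply]
      exact ⟨c, fun v => by rw [← hc, RelIso.symm_apply_apply]⟩
  · refine numVertexOrbits_eq_two (side := fun v => (e v).isLeft) ?_ ?_ ?_
    · intro φ v
      have := isLeft_mergeAut h₁.degree h₂.degree h₄.degree h₅.degree hne
        ((e.symm.trans φ).trans e) (e v)
      simpa using this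
    · intro v w hvw
      obtain ⟨ψ, hψ⟩ := exists_mergeAut_vertex (Λ₂ := Λ₂) hpres h₁.vertexTransitive
        h₄.vertexTransitive h₅.vertexTransitive _ _ hvw
      exact ⟨(e.trans ψ).trans e.symm, by simp [hψ]⟩
    · rintro (_ | _)
      · exact ⟨e.symm (.inr (i, z)), by simp⟩
      · exact ⟨e.symm (.inl (i, y)), by simp⟩
  · refine numEdgeOrbits_eq_three (side := fun v => (e v).isLeft) ?_ ?_ ?_
    · intro φ v
      have := isLeft_mergeAut h₁.degree h₂.degree h₄.degree h₅.degree hne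
        ((e.symm.trans φ).trans e) (e v)
      simpa using this
    · intro u v u' v' h h' hu hv
      obtain ⟨ψ, hψ, hψ'⟩ := exists_mergeAut_arc hpres h₁.arcTransitive harc₂
        h₁.vertexTransitive h₄.arcTransitive h₄.vertexTransitive h₅.arcTransitive
        h₅.vertexTransitive _ _ _ _ (e.map_rel_iff.2 h) (e.map_rel_iff.2 h') hu hv
      exact ⟨(e.trans ψ).trans e.symm, by simp [hψ], by simp [hψ']⟩
    · have key : ∀ u v, (merge (ofSimple Λ) Λ₂ Λ₄ Λ₅).Adj u v →
          ∃ u' v', Γ.Adj u' v' ∧ (e u').isLeft = u.isLeft ∧ (e v').isLeft = v.isLeft :=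
        fun u v h => ⟨e.symm u, e.symm v, e.symm.map_rel_iff.2 h, by simp, by simp⟩
      obtain ⟨i', hi'⟩ := h₁.degree.exists_adj ha i
      obtain ⟨i'', hi''⟩ := h₂.degree.exists_adj hb i
      obtain ⟨y', hy'⟩ := h₄.degree.exists_adj hd₄ y
      obtain ⟨z', hz'⟩ := h₅.degree.exists_adj hd₅ z
      rintro (_ | _) (_ | _)
      · exact key (.inr (i, z)) (.inr (i'', z')) ⟨hi'', hz'⟩
      · exact key (.inr (i, z)) (.inl (i, y)) rfl
      · exact key (.inl (i, y)) (.inr (i, z)) rfl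
      · exact key (.inl (i, y)) (.inl (i', y')) ⟨hi', hy'⟩

end Merge

end NutGraph

/-! ### The connected tetravalent graph `Λ`. -/

namespace NutGraph

namespace LoopGraph

/-- A graph without loops, regarded as a simple graph. -/
def toSimple {V : Type*} (A : LoopGraph V) (h : ∀ v, ¬ A.Adj v v) : SimpleGraph V where
  Adj := A.Adj
  symm := ⟨A.symm⟩
  loopless := ⟨h⟩

theorem connected_circulant {p : ℕ} [Fact p.Prime] {S : Subgroup (ZMod p)ˣ} (hS : -1 ∈ S) :
    ((circulant p S hS).toSimple circulant_loopless).Connected := by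
  have key : ∀ (k : ℕ) (a : ZMod p),
      ((circulant p S hS).toSimple circulant_loopless).Reachable a (a + k) := by
    intro k
    induction k with
    | zero => intro a; simp
    | succ k ih =>
      intro a
      refine (ih a).trans (SimpleGraph.Adj.reachable ⟨1, S.one_mem, ?_⟩)
      push_cast
      ring
  refine ⟨fun a b => ?_⟩
  have := key (b - a).val a
  rwa [ZMod.natCast_zmod_val, add_sub_cancel] at this

/-- The steps (1, 1) and (1, -1) compose to (2, 0), and similarly to (0, 2); 2 generates the
integers modulo an odd number. -/
theorem connected_prod_cycle {a b : ℕ} (ha : 3 ≤ a) (hao : Odd a) (hbo : Odd b)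
    [NeZero a] [NeZero b] :
    (((cycle a).prod (cycle b)).toSimple fun v h => cycle_loopless ha v.1 h.1).Connected := by
  set Γ := ((cycle a).prod (cycle b)).toSimple fun v h => cycle_loopless ha v.1 h.1
  have hadj : ∀ {x x' y y'}, (x + 1 = x' ∨ x - 1 = x') → (y + 1 = y' ∨ y - 1 = y') →
      Γ.Reachable (x, y) (x', y') := fun h h' =>
    SimpleGraph.Adj.reachable ⟨cycle_adj.2 h, cycle_adj.2 h'⟩
  have key1 : ∀ (k : ℕ) x y, Γ.Reachable (x, y) (x + 2 * k, y) := by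
    intro k
    induction k with
    | zero => intro x y; simp
    | succ k ih =>
      intro x y
      refine (ih x y).trans ((hadj (.inl rfl) (.inl rfl)).trans (hadj (.inl ?_) (.inr ?_)))
      · push_cast; ring
      · ring
  have key2 : ∀ (k : ℕ) x y, Γ.Reachable (x, y) (x, y + 2 * k) := by
    intro k
    induction k with
    | zero => intro x y; simp
    | succ k ih =>
      intro x y
      refine (ih x y).trans ((hadj (.inl rfl) (.inl rfl)).trans (hadj (.inr ?_) (.inl ?_)))
      · ring
      · push_cast; ring
  have half : ∀ {c : ℕ} [NeZero c], Odd c → ∀ x y : ZMod c, ∃ k : ℕ, x + 2 * k = y := by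
    rintro c _ ⟨l, hl⟩ x y
    have h0 : (2 * l + 1 : ZMod c) = 0 := by
      have := CharP.cast_eq_zero (ZMod c) c
      rw [show (c : ZMod c) = ((2 * l + 1 : ℕ) : ZMod c) from congrArg _ hl] at this
      exact_mod_cast this
    -- `l + 1` is the inverse of 2 modulo 2l + 1.
    refine ⟨((l + 1) * (y - x)).val, ?_⟩
    rw [ZMod.natCast_zmod_val]
    linear_combination (y - x) * h0
  refine ⟨?_⟩
  rintro ⟨x, y⟩ ⟨x', y'⟩
  obtain ⟨k, rfl⟩ := half hao x x'
  obtain ⟨l, rfl⟩ := half hbo y y'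
  exact (key1 k x y).trans (key2 l _ _)

theorem exists_tetravalent {n : ℕ} (hn : 5 ≤ n) (hodd : Odd n)
    (hn' : n ≡ 1 [MOD 4] ∨ ¬ n.Prime) :
    ∃ Λ : SimpleGraph (Fin n),
      (IsTetravalentPrimeCirculant n Λ ∨ IsProductOfTwoCycles n Λ) ∧ Λ.Connected ∧
        (ofSimple Λ).IsGood 4 := by
  by_cases hp : n.Prime
  · have : Fact n.Prime := ⟨hp⟩
    have h4 : 4 ∣ n - 1 := by
      have := hn'.resolve_right (not_not_intro hp)
      exact (Nat.modEq_iff_dvd' (by omega)).1 this.symm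
    obtain ⟨S, hS⟩ := exists_subgroup_units_card h4
    have hneg : -1 ∈ S := neg_one_mem_of_even_card (hS ▸ by decide)
    let Γ := (circulant n S hneg).toSimple circulant_loopless
    let e : Fin n ≃ ZMod n := (Fintype.equivFinOfCardEq (ZMod.card n)).symm
    let f : Γ.comap e ≃g Γ := SimpleGraph.Iso.comap e Γ
    refine ⟨Γ.comap e, .inl ⟨hp, S, hS, ⟨f.trans ⟨Equiv.refl _, ?_⟩⟩⟩,
      f.connected_iff.2 (connected_circulant hneg), ?_⟩
    · intro a b
      -- `circulantGraph` symmetrises its connection set, which adds nothing here because -1 lies in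
      -- `S`.
      simp only [Equiv.refl_apply, SimpleGraph.circulantGraph, SimpleGraph.fromRel_adj]
      constructor
      · rintro ⟨-, ⟨u, hu, h⟩ | ⟨u, hu, h⟩⟩
        · exact ⟨-1 * u, S.mul_mem hneg hu, by simp [h]⟩
        · exact ⟨u, hu, by rw [h]; ring⟩
      · intro h
        refine ⟨Γ.ne_of_adj h, .inr ?_⟩
        obtain ⟨u, hu, h⟩ := h
        exact ⟨u, hu, by rw [← h]; ring⟩
    · rw [← hS]
      exact IsGood.iso (A := circulant n S hneg) (isGood_circulant hasTrivialKer_circulant_of_prime)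
        f.symm
  · obtain ⟨a, ⟨b, hab⟩, ha2, han⟩ := Nat.exists_dvd_of_not_prime2 (by omega) hp
    rw [hab, Nat.odd_mul] at hodd
    obtain ⟨hao, hbo⟩ := hodd
    have ha : 3 ≤ a := by
      obtain ⟨c, rfl⟩ := hao
      omega
    have hb : 3 ≤ b := by
      obtain ⟨c, rfl⟩ := hbo
      rcases Nat.eq_zero_or_pos c with rfl | hc
      · simp at hab; omega
      · omega
    have : NeZero a := ⟨by omega⟩
    have : NeZero b := ⟨by omega⟩
    let Γ := ((cycle a).prod (cycle b)).toSimple fun v h => cycle_loopless ha v.1 h.1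
    let e : Fin n ≃ ZMod a × ZMod b := (Fintype.equivFinOfCardEq (by simp [hab])).symm
    let f : Γ.comap e ≃g Γ := SimpleGraph.Iso.comap e Γ
    obtain ⟨ea⟩ := exists_cycle_iso ha
    obtain ⟨eb⟩ := exists_cycle_iso hb
    let g : ((cycle a).prod (cycle b)).Adj ≃r ((ofSimple (SimpleGraph.cycleGraph a)).prod
        (ofSimple (SimpleGraph.cycleGraph b))).Adj := prodIso ea eb
    exact ⟨Γ.comap e, .inr ⟨a, b, ha, hb, hab, ⟨RelIso.trans f g⟩⟩,
      f.connected_iff.2 (connected_prod_cycle ha hao hbo),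
      IsGood.iso (A := (cycle a).prod (cycle b)) ((isGood_cycle ha hao).prod (isGood_cycle hb hbo))
        f.symm⟩

end LoopGraph

end NutGraph

/-! ### Assembly of the family and the small orders. -/

namespace NutGraph

namespace LoopGraph

theorem exists_nut_merge {n m t d₄ d₅ κ : ℕ} {Λ : SimpleGraph (Fin n)}
    (hodd : Odd n) (hΛ : (ofSimple Λ).IsGood 4) (hconn : Λ.Connected) (h₄ : ExistsGood m d₄ False)
    (h₅ : ExistsGood t d₅ True) (hd₄ : d₄ ≠ 0) (hd₅ : d₅ ≠ 0) (hκ : κ = 4 ∨ κ = 16)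
    (hprod : κ * d₄ * d₅ = m * t) (hne : t + 4 * d₄ ≠ m + κ / 4 * d₅) :
    ∃ Γ : SimpleGraph (Fin (n * (m + t))), IsNutTwoThree Γ ∧
      ∃ (Λ₂ : LoopGraph (Fin n)) (Λ₄ : LoopGraph (Fin m)) (Λ₅ : LoopGraph (Fin t)),
        (κ = 4 → Λ₂ = loops (Fin n)) ∧ (κ = 16 → Λ₂ = ofSimple Λ) ∧
        Λ₄.IsArcTransitive ∧ ¬ Λ₄.IsSingular ∧ Λ₅.IsArcTransitive ∧ ¬ Λ₅.IsSingular ∧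
        Nonempty (Γ.Adj ≃r (merge (ofSimple Λ) Λ₂ Λ₄ Λ₅).Adj) := by
  obtain ⟨Λ₄, h₄, -⟩ := h₄
  obtain ⟨Λ₅, h₅, hl⟩ := h₅
  have h₂ : ∃ Λ₂ : LoopGraph (Fin n), Λ₂.IsGood (κ / 4) ∧ (Λ₂ = loops (Fin n) ∨ Λ₂ = ofSimple Λ) ∧
      (κ = 4 → Λ₂ = loops (Fin n)) ∧ (κ = 16 → Λ₂ = ofSimple Λ) := by
    rcases hκ with rfl | rfl
    · exact ⟨loops _, isGood_loops, .inl rfl, fun _ => rfl, by norm_num⟩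
    · exact ⟨ofSimple Λ, hΛ, .inr rfl, by norm_num, fun _ => rfl⟩
  obtain ⟨Λ₂, h₂, hΛ₂, hκ₄, hκ₁₆⟩ := h₂
  have hκ' : 4 * (κ / 4) = κ ∧ κ / 4 ≠ 0 := by rcases hκ with rfl | rfl <;> norm_num
  -- Loops in `Λ₄` are harmless because `Λ` has none. `Λ₂` may consist of loops, so `Λ₅` must be
  -- loopless.
  have hloop : ∀ v, ¬ (merge (ofSimple Λ) Λ₂ Λ₄ Λ₅).Adj v v := by
    rintro (v | v) h
    · exact Λ.loopless.irrefl _ h.1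
    · exact hl trivial _ h.2
  let G := (merge (ofSimple Λ) Λ₂ Λ₄ Λ₅).toSimple hloop
  let e : Fin (n * (m + t)) ≃ (Fin n × Fin m) ⊕ (Fin n × Fin t) :=
    (Fintype.equivFinOfCardEq (by simp [mul_add])).symm
  let f : G.comap e ≃g G := SimpleGraph.Iso.comap e G
  refine ⟨G.comap e, isNutTwoThree_of_iso_merge (Λ₂ := Λ₂) (Λ₄ := Λ₄) (Λ₅ := Λ₅) f hΛ hconn
    (by simpa using hodd) h₂ hΛ₂ h₄ h₅ (by norm_num) hκ'.2 hd₄ hd₅ ?_ ?_,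
    Λ₂, Λ₄, Λ₅, hκ₄, hκ₁₆, h₄.arcTransitive, h₄.trivialKer.not_isSingular, h₅.arcTransitive,
    h₅.trivialKer.not_isSingular, ⟨f⟩⟩
  · rw [Fintype.card_fin, Fintype.card_fin, hκ'.1, hprod]
  · rw [Fintype.card_fin, Fintype.card_fin, add_comm, add_comm (κ / 4 * d₅)]
    exact hne

/-- Primes give circulants, the `mk i` complete graphs, and `m₀` loops. Looplessness is needed only
for the even order t: there either a complete factor occurs, or the cofactor is even and can supply
one. -/
theorem existsGood_of_factorization {m m₀ r q : ℕ} {mp d : Fin r → ℕ} {mk : Fin q → ℕ}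
    (hp : ∀ i, (mp i).Prime) (hk : ∀ i, 2 ≤ mk i) (hd : ∀ i, Even (d i) ∧ d i ∣ mp i - 1)
    (hm : m = m₀ * (∏ i, mp i) * ∏ i, mk i) :
    ExistsGood m ((∏ i, d i) * ∏ i, (mk i - 1)) (Even m ∧ Odd (∏ i, mp i)) := by
  have h₁ : ExistsGood (∏ i, mp i) (∏ i, d i) _ :=
    .finset_prod fun i _ => existsGood_circulant (hp i) (hd i).1 (hd i).2
  have h₂ : ExistsGood (∏ i, mk i) (∏ i, (mk i - 1)) _ :=
    .finset_prod fun i _ => existsGood_complete (hk i)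
  by_cases hq : (Finset.univ : Finset (Fin q)).Nonempty
  · have := ((existsGood_loops m₀).mul h₁).mul h₂
    rw [one_mul, ← hm] at this
    exact this.mono fun _ => .inr hq
  by_cases hm₀ : Even m₀
  · obtain ⟨c, rfl⟩ := even_iff_two_dvd.1 hm₀
    -- The complete graph on two vertices has degree 1, so it replaces two loops without changing
    -- the total degree.
    have := (((existsGood_complete le_rfl).mul (existsGood_loops c)).mul h₁).mul h₂
    rw [← hm, mul_one, show 2 - 1 = 1 from rfl, one_mul] at this
    exact this.mono fun _ => .inl (.inl (.inl trivial))
  · have := ((existsGood_loops m₀).mul h₁).mul h₂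
    rw [one_mul, ← hm] at this
    refine this.mono fun h => absurd h.1 ?_
    rw [Finset.not_nonempty_iff_eq_empty] at hq
    rw [hm, hq, Finset.prod_empty, mul_one, Nat.not_even_iff_odd]
    exact (Nat.not_even_iff_odd.1 hm₀).mul h.2

end LoopGraph

end NutGraph

theorem mainTheorem4 (n : ℕ) (hn : 5 ≤ n) (hodd : Odd n) (hn' : n ≡ 1 [MOD 4] ∨ ¬ n.Prime) :
    -- the general family
    (∀ (m t m₀ t₀ r₁ q₁ r₂ q₂ : ℕ)
      (mp : Fin r₁ → ℕ) (mk : Fin q₁ → ℕ) (tp : Fin r₂ → ℕ) (tk : Fin q₂ → ℕ)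
      (d : Fin r₁ → ℕ) (d' : Fin r₂ → ℕ) (κ : ℕ),
      1 ≤ m → Odd m → 2 ≤ t → Even t → 1 ≤ m₀ → 1 ≤ t₀ →
      (∀ i, (mp i).Prime ∧ Odd (mp i)) → (∀ i, (tp i).Prime ∧ Odd (tp i)) →
      (∀ i, 2 ≤ mk i) → (∀ i, 2 ≤ tk i) →
      m = m₀ * (∏ i, mp i) * (∏ i, mk i) →
      t = t₀ * (∏ i, tp i) * (∏ i, tk i) →
      (∀ i, Even (d i) ∧ d i ∣ mp i - 1) → (∀ i, Even (d' i) ∧ d' i ∣ tp i - 1) →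
      (κ = 4 ∨ κ = 16) →
      κ * (∏ i, d i) * (∏ i, d' i) * (∏ i, (mk i - 1)) * (∏ i, (tk i - 1)) = m * t →
      t + 4 * (∏ i, d i) * (∏ i, (mk i - 1)) ≠
        m + κ / 4 * (∏ i, d' i) * (∏ i, (tk i - 1)) →
      ∃ Γ : SimpleGraph (Fin (n * (m + t))), NutGraph.IsNutTwoThree Γ ∧
        -- the tetravalent graph `Λ` used in the construction of `Γ`
        ∃ Λ : SimpleGraph (Fin n),
          (NutGraph.IsTetravalentPrimeCirculant n Λ ∨ NutGraph.IsProductOfTwoCycles n Λ) ∧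
          Λ.Connected ∧ (∀ v, (Λ.neighborSet v).ncard = 4) ∧
          (NutGraph.LoopGraph.ofSimple Λ).IsArcTransitive ∧
          ¬ (NutGraph.LoopGraph.ofSimple Λ).IsSingular ∧
          ∃ (Λ₂ : NutGraph.LoopGraph (Fin n)) (Λ₄ : NutGraph.LoopGraph (Fin m))
            (Λ₅ : NutGraph.LoopGraph (Fin t)),
            (κ = 4 → Λ₂ = NutGraph.LoopGraph.loops (Fin n)) ∧
            (κ = 16 → Λ₂ = NutGraph.LoopGraph.ofSimple Λ) ∧
            Λ₄.IsArcTransitive ∧ ¬ Λ₄.IsSingular ∧ Λ₅.IsArcTransitive ∧ ¬ Λ₅.IsSingular ∧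
            Nonempty (Γ.Adj ≃r
              (NutGraph.LoopGraph.merge (NutGraph.LoopGraph.ofSimple Λ) Λ₂ Λ₄ Λ₅).Adj)) ∧
    -- the small cases
    (∀ s ∈ ({17, 19, 23, 73, 79, 97, 107, 113} : Set ℕ),
      ∃ Γ : SimpleGraph (Fin (n * s)), NutGraph.IsNutTwoThree Γ) := by
  obtain ⟨Λ, hΛ, hconn, hgood⟩ := NutGraph.LoopGraph.exists_tetravalent hn hodd hn'
  constructor
  · intro m t m₀ t₀ r₁ q₁ r₂ q₂ mp mk tp tk d d' κ _ _ _ hte _ _ hmp htp hmk htk hmf htf hd hd' hκ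
      hprod hne
    have h₄ := NutGraph.LoopGraph.existsGood_of_factorization (fun i => (hmp i).1) hmk hd hmf
    have h₅ := NutGraph.LoopGraph.existsGood_of_factorization (fun i => (htp i).1) htk hd' htf
    have hpos : ∀ {r q : ℕ} {p d : Fin r → ℕ} {k : Fin q → ℕ}, (∀ i, (p i).Prime) →
        (∀ i, d i ∣ p i - 1) → (∀ i, 2 ≤ k i) → (∏ i, d i) * ∏ i, (k i - 1) ≠ 0 := by
      intro r q p d k hp hd hk
      refine mul_ne_zero (Finset.prod_ne_zero_iff.2 fun i _ h => ?_)
        (Finset.prod_ne_zero_iff.2 fun i _ => ?_)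
      · have := (hp i).two_le
        have := Nat.eq_zero_of_zero_dvd (h ▸ hd i)
        omega
      · have := hk i
        omega
    obtain ⟨Γ, hΓ, Λ₂, Λ₄, Λ₅, h⟩ := NutGraph.LoopGraph.exists_nut_merge (κ := κ) hodd hgood hconn
      (h₄.mono False.elim) (h₅.mono fun _ => ⟨hte, Finset.prod_induction _ Odd (fun _ _ => Odd.mul) odd_one
        fun i _ => (htp i).2⟩)
      (hpos (fun i => (hmp i).1) (fun i => (hd i).2) hmk)
      (hpos (fun i => (htp i).1) (fun i => (hd' i).2) htk) hκ (by rw [← hprod]; ring)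
      (by simpa only [mul_assoc] using hne)
    refine ⟨Γ, hΓ, Λ, hΛ, hconn, fun v => ?_, hgood.arcTransitive, hgood.trivialKer.not_isSingular,
      Λ₂, Λ₄, Λ₅, h⟩
    have := hgood.degree v
    rw [NutGraph.LoopGraph.sum_adjMatrix_eq_ncard] at this
    exact_mod_cast this
  -- All small orders use κ = 16 with s = m + t. Loop factors adjust the orders m and t without
  -- affecting the degrees, so each case reduces to arithmetic.
  · have key : ∀ {m t d₄ d₅ : ℕ}, NutGraph.LoopGraph.ExistsGood m d₄ False →
        NutGraph.LoopGraph.ExistsGood t d₅ True → d₄ ≠ 0 → d₅ ≠ 0 → 16 * d₄ * d₅ = m * t →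
        t + 4 * d₄ ≠ m + 4 * d₅ →
        ∃ Γ : SimpleGraph (Fin (n * (m + t))), NutGraph.IsNutTwoThree Γ :=
      fun h₄ h₅ hd₄ hd₅ hprod hne =>
        (NutGraph.LoopGraph.exists_nut_merge hodd hgood hconn h₄ h₅ hd₄ hd₅ (.inr rfl) hprod
          hne).imp fun _ h => h.1
    have loops := NutGraph.LoopGraph.existsGood_loops
    have complete : ∀ {k : ℕ}, 2 ≤ k → NutGraph.LoopGraph.ExistsGood k (k - 1) True :=
      NutGraph.LoopGraph.existsGood_complete
    have loopless : ∀ {k l d e : ℕ}, NutGraph.LoopGraph.ExistsGood k d True →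
        NutGraph.LoopGraph.ExistsGood l e False →
        NutGraph.LoopGraph.ExistsGood (k * l) (d * e) True :=
      fun h h' => (h.mul h').mono .inl
    have forget : ∀ {k d : ℕ}, NutGraph.LoopGraph.ExistsGood k d True →
        NutGraph.LoopGraph.ExistsGood k d False := fun h => h.mono False.elim
    have k2 := complete (k := 2) (by norm_num)
    have k3 := complete (k := 3) (by norm_num)
    have k4 := complete (k := 4) (by norm_num)
    have k5 := complete (k := 5) (by norm_num)
    have k8 := complete (k := 8) (by norm_num)
    have k12 := complete (k := 12) (by norm_num)
    have k16 := complete (k := 16) (by norm_num)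
    have c11 := NutGraph.LoopGraph.existsGood_circulant (p := 11) (d := 2) (by norm_num) (by decide)
      (by norm_num)
    rintro s (rfl | rfl | rfl | rfl | rfl | rfl | rfl | rfl)
    · exact key (loops 1) (loopless k2 (loops 8)) (by decide) (by decide) rfl (by decide)
    · exact key (loops 3) (loopless k4 (loops 4)) (by decide) (by decide) rfl (by decide)
    · exact key (loops 7) (loopless k8 (loops 2)) (by decide) (by decide) rfl (by decide)
    · exact key (forget (loopless k3 (forget k3)))
        (loopless k4 (forget (loopless k4 (loops 4)))) (by decide) (by decide) rfl (by decide)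
    · exact key (forget (loopless k5 (loops 3))) (loopless k16 (loops 4)) (by decide) (by decide) rfl
        (by decide)
    · exact key (loops 1) (loopless k4 (forget (loopless k3 (loops 8)))) (by decide) (by decide) rfl
        (by decide)
    · exact key (forget c11) (loopless k12 (forget (loopless k4 (loops 2)))) (by decide) (by decide)
        rfl (by decide)
    · exact key (loops 1) (loopless k8 (loops 14)) (by decide) (by decide) rfl (by decide)
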